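/- For integers $a,b,c$ with $a>0$ and $b^2-4ac<0$ and a complex number $q$ with $|q|<1$, write $$(a,b,c)=(a,b,c)(q):=\sum_{n,m=-\infty}^{\infty}q^{an^2+bnm+cm^2},\qquad E(q):=f(-q,-q^2)=\sum_{n=-\infty}^{\infty}(-1)^nq^{n(3n-1)/2},$$ where $f(x,y):=\sum_{n=-\infty}^{\infty}x^{n(n+1)/2}y^{n(n-1)/2}$ for $|xy|<1$. The series $(1,0,14)$, $(2,0,7)$, $(3,2,5)$ (forms of discriminant $-56$) and $E(q)$ converge absolutely for $|q|<1$. Let $|q|<1$ and $Q:=q^7$. Then $$\frac{(1,0,14)-(3,2,5)}{(2,0,7)+(3,2,5)}=q\,\frac{E^2(Q^4)\,E^2(q^2)}{E^2(Q^2)\,E^2(q^4)}$$ as an identity of meromorphic functions on the open unit disc. Explicitly: the denominator on the left does not vanish identically on $|q|<1$; the denominator on the right has no zero in $|q|<1$; the identity holds at every $q$ with $|q|<1$ at which $(2,0,7)+(3,2,5)\ne 0$; and for every $q$ with $|q|<1$, $$\bigl((1,0,14)-(3,2,5)\bigr)E^2(Q^2)E^2(q^4)=q\,E^2(Q^4)E^2(q^2)\bigl((2,0,7)+(3,2,5)\bigr).$$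 -/

import Mathlib

/-- The generating function `∑_{n,m ∈ ℤ} q ^ (a n² + b n m + c m²)` of the binary quadratic form
`(a, b, c)`. It is used only for positive definite forms, whose values are nonnegative, so that
`Int.toNat` does not change the exponent. -/
noncomputable def formSeries (a b c : ℤ) (q : ℂ) : ℂ :=
  ∑' p : ℤ × ℤ, q ^ (a * p.1 ^ 2 + b * p.1 * p.2 + c * p.2 ^ 2).toNat

/-- Ramanujan's general theta function `f(a, b) = ∑_{n ∈ ℤ} a ^ (n(n+1)/2) b ^ (n(n-1)/2)`,
`|ab| < 1`. Both exponents are nonnegative integers and the divisions are exact. -/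
noncomputable def ramanujanTheta (a b : ℂ) : ℂ :=
  ∑' n : ℤ, a ^ (n * (n + 1) / 2).toNat * b ^ (n * (n - 1) / 2).toNat

/-- `E(q) = f(-q, -q²) = ∑_{n ∈ ℤ} (-1)^n q ^ (n(3n-1)/2)`. -/
noncomputable def eulerE (q : ℂ) : ℂ :=
  ramanujanTheta (-q) (-q ^ 2)

/-! Put q = exp(πiτ) with Im τ > 0. The three series become weight-one theta functions A, B, C of
forms with Gram determinant 14. For C the equivalent form (5, -28, 42) is used, because 14 divides
its last two coefficients. By Euler's pentagonal number theorem (`eulerE_eq_eulerProd`) the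
right-hand side becomes the eta quotient h = (η(τ)η(14τ) / (η(2τ)η(7τ)))². The claim is that the
defect A - C - h(B + C) vanishes on the upper half-plane.

The translation τ ↦ τ + 1 and the Atkin-Lehner involutions W₁₄, W₇, W₂ (the last two written around
1/2 and 2/7) do not fix this defect. They carry it to three companions, built from the thetas with
sign (-1)^x and with second variable shifted by 1/2. For the thetas this is Poisson summation,
preceded for W₇ and W₂ by a finite Fourier expansion modulo 2 or 7: W₁₄ preserves each class, while
W₇ and W₂ exchange A and B. For h it is the modularity of the discriminant together with an
evaluation at a special point: h is invariant under W₁₄, and h · (h ∘ W) is -1 for W₇ and 1 for W₂.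
Hence the four defects are permuted transitively, up to nonvanishing factors.

Let P be the product of the four defects, of weight 4. The modulus of (P / h²)¹² / ∏ Δ(dτ), with d
running over the divisors 1, 2, 7, 14, is invariant under all these maps (`norm_invQuot_fricke`,
`norm_invQuot_half`, `norm_invQuot_two_sevenths`). They bring every point to height at least 1/20
(`exists_reduced`), so only the cusp i∞ has to be examined. There P = O(|q|⁷), whereas the
denominators have order 72 against 12 · 7 = 84, so the quotient tends to 0 (`tendsto_invQuot`). The
maximum principle makes it constant, hence zero. So P = 0, one defect vanishes identically, and
transitivity gives `defect₀₀_eq_zero`. -/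

section thetaIdentity

open Complex Filter Topology Asymptotics

/-! ### Convergence and holomorphy of binary theta series -/

/-- The binary theta function with characteristics
`∑ exp (2πi (u x + v y)) exp (πi τ Q(x + s, y + t))`, where `Q` has Gram matrix `(a, b; b, c)`. -/
noncomputable def binTheta (a b c u v s t : ℝ) (τ : ℂ) : ℂ :=
  ∑' p : ℤ × ℤ, cexp (2 * Real.pi * I * (u * p.1 + v * p.2) + Real.pi * I * τ *
    (a * (p.1 + s) ^ 2 + 2 * b * (p.1 + s) * (p.2 + t) + c * (p.2 + t) ^ 2))

lemma norm_cexp_binTheta (a b c u v s t x y : ℝ) (τ : ℂ) :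
    ‖cexp (2 * Real.pi * I * (u * x + v * y) + Real.pi * I * τ *
      (a * (x + s) ^ 2 + 2 * b * (x + s) * (y + t) + c * (y + t) ^ 2))‖ =
    Real.exp (-Real.pi * τ.im *
      (a * (x + s) ^ 2 + 2 * b * (x + s) * (y + t) + c * (y + t) ^ 2)) := by
  rw [Complex.norm_exp]
  congr 1
  have : (2 * Real.pi * I * (u * x + v * y) + Real.pi * I * τ *
      (a * (x + s) ^ 2 + 2 * b * (x + s) * (y + t) + c * (y + t) ^ 2) : ℂ) =
      ((2 * Real.pi * (u * x + v * y) + Real.pi * 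
      (a * (x + s) ^ 2 + 2 * b * (x + s) * (y + t) + c * (y + t) ^ 2) * τ.re : ℝ) : ℂ) * I +
      ((-Real.pi * τ.im *
      (a * (x + s) ^ 2 + 2 * b * (x + s) * (y + t) + c * (y + t) ^ 2) : ℝ) : ℂ) := by
    conv_lhs => rw [← Complex.re_add_im τ]
    push_cast
    ring_nf
    simp only [I_sq]
    ring
  rw [this, add_re, re_ofReal_mul, I_re, ofReal_re, mul_zero, zero_add]

lemma summable_exp_neg_sq {r : ℝ} (hr : 0 < r) (s : ℝ) :
    Summable fun n : ℤ => Real.exp (-r * (n + s) ^ 2) := by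
  have h := (summable_jacobiTheta₂_term_iff (I * (r * s / Real.pi)) (I * (r / Real.pi))).2
    (by simp; positivity)
  have h2 := (h.norm).mul_left (Real.exp (-r * s ^ 2))
  refine h2.congr fun n => ?_
  rw [norm_jacobiTheta₂_term, ← Real.exp_add]
  congr 1
  have : (I * (r / Real.pi : ℂ)).im = r / Real.pi := by
    rw [← Complex.ofReal_div]; simp
  have h' : (I * (r * s / Real.pi : ℂ)).im = r * s / Real.pi := by
    rw [← Complex.ofReal_mul, ← Complex.ofReal_div]; simp
  rw [this, h']
  field_simp
  ring

/-- The constant is determinant over trace, λμ/(λ + μ) in terms of the eigenvalues, which is below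
both of them. -/
lemma exists_quadForm_ge {a b c : ℝ} (ha : 0 < a) (hD : 0 < a * c - b ^ 2) :
    ∃ r > 0, ∀ x y : ℝ, r * (x ^ 2 + y ^ 2) ≤ a * x ^ 2 + 2 * b * x * y + c * y ^ 2 := by
  have hc : 0 < c := by nlinarith [sq_nonneg b]
  refine ⟨(a * c - b ^ 2) / (a + c), by positivity, fun x y => ?_⟩
  rw [div_mul_eq_mul_div, div_le_iff₀ (by positivity)]
  nlinarith [sq_nonneg (a * x + b * y), sq_nonneg (b * x + c * y)]

lemma summable_exp_neg_quadForm {a b c : ℝ} (ha : 0 < a) (hD : 0 < a * c - b ^ 2) (s t : ℝ)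
    {r : ℝ} (hr : 0 < r) :
    Summable fun p : ℤ × ℤ => Real.exp (-r *
      (a * (p.1 + s) ^ 2 + 2 * b * (p.1 + s) * (p.2 + t) + c * (p.2 + t) ^ 2)) := by
  obtain ⟨k, hk, h⟩ := exists_quadForm_ge ha hD
  have h1 := (summable_exp_neg_sq (mul_pos hr hk) s).mul_of_nonneg
    (summable_exp_neg_sq (mul_pos hr hk) t) (fun _ => (Real.exp_pos _).le)
    (fun _ => (Real.exp_pos _).le)
  refine h1.of_nonneg_of_le (fun _ => (Real.exp_pos _).le) fun p => ?_
  rw [← Real.exp_add]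
  apply Real.exp_le_exp.2
  nlinarith [h (p.1 + s) (p.2 + t)]

lemma summable_norm_binTheta {a b c : ℝ} (ha : 0 < a) (hD : 0 < a * c - b ^ 2) (u v s t : ℝ)
    {τ : ℂ} (hτ : 0 < τ.im) :
    Summable fun p : ℤ × ℤ => ‖cexp (2 * Real.pi * I * (u * p.1 + v * p.2) + Real.pi * I * τ *
      (a * (p.1 + s) ^ 2 + 2 * b * (p.1 + s) * (p.2 + t) + c * (p.2 + t) ^ 2))‖ := by
  refine (summable_exp_neg_quadForm ha hD s t (mul_pos Real.pi_pos hτ)).congr fun p => ?_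
  have := norm_cexp_binTheta a b c u v s t p.1 p.2 τ
  push_cast at this
  rw [this]
  ring_nf

lemma differentiableOn_binTheta {a b c : ℝ} (ha : 0 < a) (hD : 0 < a * c - b ^ 2) (u v s t : ℝ) :
    DifferentiableOn ℂ (binTheta a b c u v s t) {τ : ℂ | 0 < τ.im} := by
  intro τ₀ h₀
  have h₀' : 0 < τ₀.im := h₀
  -- On the half-plane above height Im τ₀ / 2 the terms are dominated by their moduli at that
  -- height.
  have hopen : IsOpen {τ : ℂ | τ₀.im / 2 < τ.im} := isOpen_lt continuous_const continuous_im
  have hd : DifferentiableOn ℂ (binTheta a b c u v s t) {τ : ℂ | τ₀.im / 2 < τ.im} := by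
    refine differentiableOn_tsum_of_summable_norm
      (summable_exp_neg_quadForm ha hD s t (mul_pos Real.pi_pos (half_pos h₀')))
      (fun p => by fun_prop) hopen fun p τ hτ => ?_
    have := norm_cexp_binTheta a b c u v s t p.1 p.2 τ
    push_cast at this
    rw [this]
    apply Real.exp_le_exp.2
    obtain ⟨k, hk, h⟩ := exists_quadForm_ge ha hD
    have hQ : 0 ≤ a * (p.1 + s) ^ 2 + 2 * b * (p.1 + s) * (p.2 + t) + c * (p.2 + t) ^ 2 :=
      le_trans (by positivity) (h (p.1 + s) (p.2 + t))
    have hτ' : τ₀.im / 2 < τ.im := hτ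
    have := mul_le_mul_of_nonneg_right (mul_le_mul_of_nonneg_left hτ'.le Real.pi_pos.le) hQ
    linarith
  exact ((hd.differentiableAt (hopen.mem_nhds (by simp; linarith)))).differentiableWithinAt

/-! ### Poisson summation for binary theta series -/

lemma tsum_prod_symm {f : ℤ × ℤ → ℂ} (h : Summable f) :
    ∑' p, f p = ∑' y : ℤ, ∑' x : ℤ, f (x, y) := by
  rw [h.tsum_prod]
  exact (Summable.tsum_comm (f := fun x y => f (x, y)) h).symm

lemma gauss_exponent (w : ℂ) (hw : w ≠ 0) (z : ℂ) :
    -Real.pi / (-I * w) * z = -(Real.pi * I / w) * z := by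
  field_simp
  rw [I_sq]; ring

lemma mul_cpow_half_ofReal {α : ℝ} (hα : 0 < α) (z : ℂ) :
    (z * α) ^ (1 / 2 : ℂ) = z ^ (1 / 2 : ℂ) * Real.sqrt α := by
  rcases eq_or_ne z 0 with rfl | hz
  · simp
  · have hα0 : (α : ℂ) ≠ 0 := by exact_mod_cast hα.ne'
    rw [cpow_def_of_ne_zero (mul_ne_zero hz hα0), cpow_def_of_ne_zero hz,
      log_mul_ofReal α hα z hz, add_mul, Complex.exp_add, mul_comm, Real.sqrt_eq_rpow,
      Real.rpow_def_of_pos hα]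
    push_cast
    rfl

lemma tsum_exp_add_quadratic {w : ℂ} (hw : 0 < (-I * w).re) (b k : ℂ) :
    ∑' n : ℤ, cexp (k + (Real.pi * I * w * n ^ 2 + 2 * Real.pi * I * b * n)) =
      1 / (-I * w) ^ (1 / 2 : ℂ) * ∑' n : ℤ, cexp (k - Real.pi * I / w * (n - b) ^ 2) := by
  have hw0 : w ≠ 0 := by rintro rfl; simp at hw
  have h := Complex.tsum_exp_neg_quadratic hw (I * b)
  calc _ = cexp k * ∑' n : ℤ, cexp (-Real.pi * (-I * w) * n ^ 2 + 2 * Real.pi * (I * b) * n) := by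
        rw [← tsum_mul_left]
        refine tsum_congr fun n => ?_
        rw [← Complex.exp_add]
        congr 1
        ring
    _ = _ := by
        rw [h, mul_left_comm, ← tsum_mul_left]
        congr 1
        refine tsum_congr fun n => ?_
        rw [gauss_exponent w hw0, ← Complex.exp_add]
        congr 1
        linear_combination (-(Real.pi * I / w) * (2 * n * b + I * I * b ^ 2 - b ^ 2)) * I_sq

set_option maxHeartbeats 800000 in
-- Two successive one-variable Gaussian transformations. Completing the square in x leaves a
-- Gaussian in y with parameter τD/a, where D is the determinant. The dual variables carry the
-- inverse Gram matrix, with their order exchanged.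
lemma binTheta_poisson {a b c : ℝ} (ha : 0 < a) (hD : 0 < a * c - b ^ 2) (u v t : ℝ)
    {τ : ℂ} (hτ : 0 < τ.im) :
    binTheta a b c u v 0 t τ = I / (τ * Real.sqrt (a * c - b ^ 2)) *
      cexp (-2 * Real.pi * I * v * t) * binTheta (a / (a * c - b ^ 2)) (-b / (a * c - b ^ 2))
        (c / (a * c - b ^ 2)) (-t) 0 v u (-1 / τ) := by
  set D := a * c - b ^ 2 with hDdef
  have hτ0 : τ ≠ 0 := by rintro rfl; simp at hτ
  have haC : (a : ℂ) ≠ 0 := by exact_mod_cast ha.ne'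
  have hDC : (D : ℂ) ≠ 0 := by exact_mod_cast hD.ne'
  have hDC' : (D : ℂ) = a * c - b ^ 2 := by rw [hDdef]; push_cast; ring
  have hτI : 0 < (-1 / τ).im := by
    have : 0 < normSq τ := normSq_pos.2 hτ0
    rw [neg_div, one_div, neg_im, inv_im]; field_simp; linarith
  have hpi : (Real.pi : ℂ) ≠ 0 := by exact_mod_cast Real.pi_ne_zero
  -- the intermediate summand, obtained by summing over the first variable
  let F : ℤ → ℤ → ℂ := fun X y => cexp (-(Real.pi * I / (τ * a)) * (X - u) ^ 2 +
    2 * Real.pi * I * (X - u) * ((b / a) * (y + t)) + 2 * Real.pi * I * v * y +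
    Real.pi * I * τ * (D / a) * (y + t) ^ 2)
  have hFsum : Summable fun p : ℤ × ℤ => F p.1 p.2 := by
    have h1 := (summable_exp_neg_sq (r := Real.pi * (-1 / τ).im / a) (by positivity) (-u)).mul_of_nonneg
      (summable_exp_neg_sq (r := Real.pi * τ.im * (D / a)) (by positivity) t)
      (fun _ => (Real.exp_pos _).le) (fun _ => (Real.exp_pos _).le)
    apply Summable.of_norm
    refine h1.congr fun p => ?_
    simp only [F]
    rw [Complex.norm_exp, ← Real.exp_add]
    congr 1
    have e1 : (-(Real.pi * I / (τ * a)) * (p.1 - u) ^ 2 +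
      2 * Real.pi * I * (p.1 - u) * ((b / a) * (p.2 + t)) + 2 * Real.pi * I * v * p.2 +
      Real.pi * I * τ * (D / a) * (p.2 + t) ^ 2 : ℂ) =
      ((Real.pi / a * (p.1 - u) ^ 2 : ℝ) : ℂ) * (I * (-1 / τ)) +
      ((2 * Real.pi * (p.1 - u) * ((b / a) * (p.2 + t)) + 2 * Real.pi * v * p.2 : ℝ) : ℂ) * I +
      ((Real.pi * (D / a) * (p.2 + t) ^ 2 : ℝ) : ℂ) * (I * τ) := by
      push_cast
      field_simp
      ring
    rw [e1]
    simp only [add_re, re_ofReal_mul, I_mul_re, I_re]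
    ring
  have hx : ∀ y : ℤ, ∑' x : ℤ, cexp (2 * Real.pi * I * (u * x + v * y) + Real.pi * I * τ *
      (a * (x + (0 : ℝ)) ^ 2 + 2 * b * (x + (0 : ℝ)) * (y + t) + c * (y + t) ^ 2)) =
      1 / (-I * (τ * a)) ^ (1 / 2 : ℂ) * ∑' X : ℤ, F X y := by
    intro y
    have h := tsum_exp_add_quadratic (w := τ * a)
      (by simpa using mul_pos hτ ha) (τ * (b * (y + t)) + u)
      (2 * Real.pi * I * v * y + Real.pi * I * τ * c * (y + t) ^ 2)
    refine (tsum_congr fun x => ?_).trans (h.trans (congrArg _ (tsum_congr fun X => ?_)))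
    · congr 1
      push_cast
      ring
    · simp only [F]
      congr 1
      rw [hDC']
      field_simp
      ring
  have hy : ∀ X : ℤ, ∑' y : ℤ, F X y = 1 / (-I * (τ * (D / a : ℝ))) ^ (1 / 2 : ℂ) *
      ∑' Y : ℤ, cexp (2 * Real.pi * I * ((Y - v) * t) - Real.pi * I * (1 / τ) *
        ((a / D : ℝ) * (Y - v) ^ 2 - 2 * (b / D : ℝ) * (Y - v) * (X - u) +
          (c / D : ℝ) * (X - u) ^ 2)) := by
    intro X
    have h := tsum_exp_add_quadratic (w := τ * (D / a : ℝ))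
      (by rw [← mul_assoc, re_mul_ofReal]; exact mul_pos (by simpa using hτ) (div_pos hD ha))
      ((X - u) * (b / a) + v + τ * (D / a) * t)
      (-(Real.pi * I / (τ * a)) * (X - u) ^ 2 +
      2 * Real.pi * I * (X - u) * ((b / a) * t) + Real.pi * I * τ * (D / a) * t ^ 2)
    refine (tsum_congr fun y => ?_).trans (h.trans (congrArg _ (tsum_congr fun Y => ?_)))
    · simp only [F]
      congr 1
      push_cast
      ring
    · congr 1
      have hc : (c : ℂ) = (D + b ^ 2) / a := by rw [hDC']; field_simp; ring
      push_cast
      rw [hc]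
      field_simp
      ring
  -- Positive real factors leave the principal root alone, so the two roots of -iτ multiply to -iτ
  -- and the real parts to √D.
  have hfac : 1 / (-I * (τ * a)) ^ (1 / 2 : ℂ) * (1 / (-I * (τ * (D / a : ℝ))) ^ (1 / 2 : ℂ)) =
      I / (τ * Real.sqrt D) := by
    rw [← mul_assoc, ← mul_assoc, mul_cpow_half_ofReal ha, mul_cpow_half_ofReal (div_pos hD ha)]
    have e1 : (-I * τ) ^ (1 / 2 : ℂ) * (-I * τ) ^ (1 / 2 : ℂ) = -I * τ := by
      rw [← Complex.cpow_add _ _ (mul_ne_zero (by simp) hτ0)]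
      norm_num
    have e2 : Real.sqrt a * Real.sqrt (D / a) = Real.sqrt D := by
      rw [← Real.sqrt_mul ha.le]
      congr 1
      field_simp
    have e2' : (Real.sqrt a : ℂ) * Real.sqrt (D / a) = Real.sqrt D := by exact_mod_cast e2
    rw [div_mul_div_comm, mul_mul_mul_comm, e1, e2', one_mul]
    have : (Real.sqrt D : ℂ) ≠ 0 := by exact_mod_cast (Real.sqrt_pos.2 hD).ne'
    field_simp
    rw [I_sq]
  have hsum1 := (summable_norm_binTheta ha hD u v 0 t hτ).of_norm
  have hQ : 0 < a / D := div_pos ha hD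
  have hQD : 0 < a / D * (c / D) - (-b / D) ^ 2 := by
    have : a / D * (c / D) - (-b / D) ^ 2 = 1 / D := by
      field_simp
      rw [hDdef]
    rw [this]; positivity
  have hsum2 := (summable_norm_binTheta hQ hQD (-t) 0 v u hτI).of_norm
  have hswap : ∑' y : ℤ, ∑' X : ℤ, F X y = ∑' X : ℤ, ∑' y : ℤ, F X y :=
    Summable.tsum_comm (f := F) hFsum
  unfold binTheta
  rw [tsum_prod_symm hsum1]
  simp_rw [hx]
  rw [tsum_mul_left, hswap]
  simp_rw [hy]
  rw [tsum_mul_left, ← mul_assoc, hfac, mul_assoc (I / _)]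
  congr 1
  rw [← tsum_mul_left, tsum_prod_symm (hsum2.mul_left _)]
  -- The dual indices appear as X - u and Y - v; negating both gives the shifts +u and +v.
  rw [← (Equiv.neg ℤ).tsum_eq]
  congr 1
  ext X
  rw [← (Equiv.neg ℤ).tsum_eq]
  congr 1
  ext Y
  rw [← Complex.exp_add]
  congr 1
  simp only [Equiv.neg_apply]
  push_cast
  field_simp
  ring

lemma cexp_congr {z w : ℂ} (n : ℤ) (h : z = w + n * (2 * Real.pi * I)) : cexp z = cexp w := by
  rw [h, Complex.exp_add, Complex.exp_int_mul_two_pi_mul_I, mul_one]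

lemma hasSum_residues {N : ℕ} (hN : N ≠ 0) {f : ℤ × ℤ → ℂ} {S : ℕ → ℂ}
    (h : ∀ r ∈ Finset.range N, HasSum (fun p : ℤ × ℤ => f (p.1, N * p.2 + r)) (S r)) :
    HasSum f (∑ r ∈ Finset.range N, S r) := by
  classical
  have hN' : (0 : ℤ) < N := by positivity
  have key : ∀ r ∈ Finset.range N,
      HasSum (fun p : ℤ × ℤ => if p.2 % N = r then f p else 0) (S r) := by
    intro r hr
    have hr' : (r : ℤ) < N := by exact_mod_cast Finset.mem_range.1 hr
    have hinj : Function.Injective (fun p : ℤ × ℤ => ((p.1, N * p.2 + r) : ℤ × ℤ)) := by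
      rintro ⟨a, b⟩ ⟨c, d⟩ hh
      simp only [Prod.mk.injEq, add_left_inj, mul_eq_mul_left_iff] at hh
      obtain ⟨h1, h2 | h2⟩ := hh
      · simp [h1, h2]
      · omega
    rw [← hinj.hasSum_iff]
    · convert h r hr using 2 with p
      simp only [Function.comp, Int.mul_add_emod_self_left]
      rw [if_pos (Int.emod_eq_of_lt (by positivity) hr')]
    · rintro ⟨x, y⟩ hxy
      rw [if_neg]
      intro hy
      exact hxy ⟨(x, y / N), by
        simp only [Prod.mk.injEq, true_and]
        rw [← hy]; exact Int.mul_ediv_add_emod y N⟩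
  convert hasSum_sum key using 2 with p
  have h0 : 0 ≤ p.2 % (N : ℤ) := Int.emod_nonneg _ hN'.ne'
  have h1 : p.2 % (N : ℤ) < N := Int.emod_lt_of_pos _ hN'
  rw [Finset.sum_eq_single (p.2 % (N : ℤ)).toNat]
  · rw [if_pos (by omega)]
  · intro b _ hb
    rw [if_neg (by omega)]
  · intro hb
    simp at hb
    omega

/-- Poisson summation for a finite combination of characters modulo `N` in the first variable. -/
lemma sum_binTheta_poisson {a b c : ℝ} (ha : 0 < a) (hD : 0 < a * c - b ^ 2) (u v t : ℝ)
    {τ : ℂ} (hτ : 0 < τ.im) {N : ℕ} (hN : N ≠ 0) (g : ℤ → ℂ)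
    (hg : ∀ m n : ℤ, g (N * m + n) = g n) :
    ∑ r ∈ Finset.range N, g r * binTheta a b c (u + r / N) v 0 t τ =
      I / (τ * Real.sqrt (a * c - b ^ 2)) * cexp (-2 * Real.pi * I * v * t) *
      ∑' p : ℤ × ℤ, g p.2 * cexp (-2 * Real.pi * I * t * p.1 - Real.pi * I / τ *
        (a * (p.1 + v) ^ 2 - 2 * b * (p.1 + v) * (p.2 / N + u) + c * (p.2 / N + u) ^ 2) /
          (a * c - b ^ 2)) := by
  have hτ0 : τ ≠ 0 := by rintro rfl; simp at hτ
  have hDC : (a * c - b ^ 2 : ℂ) ≠ 0 := by exact_mod_cast hD.ne'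
  have hNC : (N : ℂ) ≠ 0 := by exact_mod_cast hN
  have hτI : 0 < (-1 / τ).im := by
    have : 0 < normSq τ := normSq_pos.2 hτ0
    rw [neg_div, one_div, neg_im, inv_im]; field_simp; linarith
  have hQD : 0 < a / (a * c - b ^ 2) * (c / (a * c - b ^ 2)) - (-b / (a * c - b ^ 2)) ^ 2 := by
    have : a / (a * c - b ^ 2) * (c / (a * c - b ^ 2)) - (-b / (a * c - b ^ 2)) ^ 2 =
      1 / (a * c - b ^ 2) := by
      field_simp
    rw [this]; positivity
  simp_rw [binTheta_poisson ha hD _ v t hτ, mul_left_comm (g _), ← Finset.mul_sum]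
  congr 1
  -- The character with frequency r/N shifts the dual variable by r/N, so the N dual lattices y +
  -- r/N are the residue classes of (Ny + r)/N.
  refine (HasSum.tsum_eq (hasSum_residues hN fun r _ => ?_)).symm
  have h := ((summable_norm_binTheta (div_pos ha hD) hQD (-t) 0 v (u + r / N) hτI).of_norm).hasSum
  have h' := h.mul_left (g r)
  unfold binTheta
  refine (congrArg (fun f => HasSum f _) (funext fun p => ?_)).mpr h'
  rw [hg]
  congr 2
  push_cast
  field_simp
  ring

/-! ### Half-integral characteristics and the maps of level 14 -/

/-- The binary theta function of the form `(a, b; b, c)` with the character `(-1) ^ (ε x)` and the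
second variable shifted by `δ / 2`. -/
noncomputable def charTheta (a b c ε δ : ℤ) (τ : ℂ) : ℂ := binTheta a b c (ε / 2) 0 0 (δ / 2) τ

lemma charTheta_eq (a b c ε δ : ℤ) (τ : ℂ) :
    charTheta a b c ε δ τ = ∑' p : ℤ × ℤ, cexp (Real.pi * I * ε * p.1 + Real.pi * I * τ *
      (a * p.1 ^ 2 + 2 * b * p.1 * (p.2 + δ / 2) + c * (p.2 + δ / 2) ^ 2)) := by
  unfold charTheta binTheta
  refine tsum_congr fun p => ?_
  congr 1
  push_cast
  ring

lemma charTheta_neg (a b c ε δ : ℤ) (τ : ℂ) :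
    charTheta a (-b) c ε δ τ = charTheta a b c ε δ τ := by
  rw [charTheta_eq, charTheta_eq, ← ((Equiv.neg ℤ).prodCongr (Equiv.refl ℤ)).tsum_eq]
  refine tsum_congr fun p => cexp_congr (-ε * p.1) ?_
  simp only [Equiv.prodCongr_apply, Prod.map, Equiv.neg_apply, Equiv.refl_apply]
  push_cast
  ring

lemma charTheta_conj (a b c ε δ : ℤ) (τ : ℂ) :
    charTheta a b c ε δ (-(starRingEnd ℂ τ)) = starRingEnd ℂ (charTheta a b c ε δ τ) := by
  rw [charTheta_eq, charTheta_eq, conj_tsum]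
  refine tsum_congr fun p => ?_
  rw [← Complex.exp_conj]
  refine cexp_congr (ε * p.1) ?_
  simp only [map_add, map_mul, map_pow, map_div₀, conj_I, conj_ofReal, map_intCast, map_ofNat]
  push_cast
  ring

/-- By the parities, the form at (x, y + δ/2) is congruent to x + cδ²/4 modulo 2, so translation
toggles the character (-1)^x. -/
lemma charTheta_add_one {a b c : ℤ} (ha : Odd a) (hb : Even b) (hc : Even c) (ε δ : ℤ) (τ : ℂ) :
    charTheta a b c ε δ (τ + 1) =
      cexp (Real.pi * I * (c * δ ^ 2 / 4)) * charTheta a b c (1 - ε) δ τ := by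
  obtain ⟨a, rfl⟩ := ha
  obtain ⟨b, rfl⟩ := hb
  obtain ⟨c, rfl⟩ := hc
  rw [charTheta_eq, charTheta_eq, ← tsum_mul_left]
  refine tsum_congr fun p => ?_
  obtain ⟨m, hm⟩ := Int.even_mul_pred_self p.1
  have hm' : (p.1 * (p.1 - 1) : ℂ) = m + m := by exact_mod_cast hm
  rw [← Complex.exp_add]
  refine cexp_congr (a * p.1 ^ 2 + m + 2 * b * p.1 * p.2 + b * p.1 * δ + c * p.2 ^ 2 + c * p.2 * δ
    + ε * p.1) ?_
  push_cast
  linear_combination (Real.pi * I) * hm'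

lemma sqrt_fourteen_sq : ((Real.sqrt 14 : ℝ) : ℂ) ^ 2 = 14 := by
  rw [← ofReal_pow, Real.sq_sqrt (by norm_num)]; norm_num

/-- The inverse Gram matrix is the adjugate divided by 14. After the exchange of variables it is the
original form with -b for b, and the character and the shift trade places. -/
lemma charTheta_inv {a b c : ℤ} (ha : 0 < a) (hD : a * c - b ^ 2 = 14) (ε δ : ℤ) {τ : ℂ}
    (hτ : 0 < τ.im) :
    charTheta a b c ε δ τ = I / (τ * Real.sqrt 14) * charTheta a b c δ ε (-1 / (14 * τ)) := by
  have hτ0 : τ ≠ 0 := by rintro rfl; simp at hτ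
  have ha' : (0 : ℝ) < a := by exact_mod_cast ha
  have hD' : (a * c - b ^ 2 : ℝ) = 14 := by exact_mod_cast hD
  rw [← charTheta_neg a b c δ ε, charTheta_eq a (-b)]
  unfold charTheta
  rw [binTheta_poisson ha' (by rw [hD']; norm_num) _ _ _ hτ]
  simp only [hD']
  have e1 : cexp (-2 * Real.pi * I * ((0 : ℝ) : ℂ) * ((δ / 2 : ℝ) : ℂ)) = 1 := by simp
  rw [e1, mul_one]
  congr 1
  unfold binTheta
  refine tsum_congr fun p => cexp_congr (-δ * p.1) ?_
  push_cast
  field_simp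
  ring

/-- Since 14 divides the other entries, translation by 2/7 affects only exp(2πi a x²/7), up to a
constant phase. The Gauss sum expands this factor in additive characters modulo 7 whose coefficients
are again quadratic phases. After Poisson summation these coefficients become the translation by
-2/7 of the dual theta. -/
lemma charTheta_two_sevenths {a b c : ℤ} (ha : 0 < a) (hD : a * c - 14 * b ^ 2 = 1) {G : ℂ}
    (hG0 : G ≠ 0) (hG : ∀ x : ℤ, ∑ r ∈ Finset.range 7, cexp (2 * Real.pi * I * (-2 * c * r ^ 2) / 7) *
      cexp (2 * Real.pi * I * (r / 7) * x) = G * cexp (2 * Real.pi * I * a * x ^ 2 / 7))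
    (ε δ : ℤ) {z : ℂ} (hz : 0 < z.im) :
    charTheta a (14 * b) (14 * c) ε δ (2 / 7 + z) =
      cexp (Real.pi * I * (c * (δ ^ 2 - 5 * ε ^ 2))) / G * (I / (z * Real.sqrt 14)) *
        charTheta (7 * a) (-(14 * b)) (2 * c) δ ε (-(2 / 7) - 1 / (98 * z)) := by
  have hz0 : z ≠ 0 := by rintro rfl; simp at hz
  have ha' : (0 : ℝ) < a := by exact_mod_cast ha
  have hDR : (a * c - 14 * b ^ 2 : ℝ) = 1 := by exact_mod_cast hD
  have hD' : (a * (14 * c) - (14 * b) ^ 2 : ℝ) = 14 := by linear_combination 14 * hDR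
  have hD'' : (a * (14 * c) - (14 * b) ^ 2 : ℂ) = 14 := by exact_mod_cast hD'
  set g : ℤ → ℂ := fun n => cexp (2 * Real.pi * I * (-2 * c * n ^ 2) / 7) with hgdef
  have hg' : ∀ n : ℤ, g n = cexp (2 * Real.pi * I * (-2 * c * n ^ 2) / 7) := fun _ => rfl
  have hg : ∀ m n : ℤ, g ((7 : ℕ) * m + n) = g n := by
    intro m n
    refine cexp_congr (-2 * c * (7 * m ^ 2 + 2 * m * n)) ?_
    push_cast
    ring
  have key := sum_binTheta_poisson (a := a) (b := 14 * b) (c := 14 * c) ha'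
    (by rw [hD']; norm_num) (ε / 2) 0 (δ / 2) hz (N := 7) (by norm_num) g hg
  have hsplit : charTheta a (14 * b) (14 * c) ε δ (2 / 7 + z) =
      cexp (Real.pi * I * (c * δ ^ 2)) / G * ∑ r ∈ Finset.range 7, g r *
        binTheta a (14 * b) (14 * c) (ε / 2 + r / (7 : ℕ)) 0 0 (δ / 2) z := by
    have hs : ∀ r ∈ Finset.range 7, Summable fun p : ℤ × ℤ => g r *
        cexp (2 * Real.pi * I * (((ε / 2 + r / (7 : ℕ) : ℝ) : ℂ) * p.1 + ((0 : ℝ) : ℂ) * p.2) +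
        Real.pi * I * z * ((a : ℝ) * (p.1 + ((0 : ℝ) : ℂ)) ^ 2 + 2 * ((14 * b : ℝ) : ℂ) *
        (p.1 + ((0 : ℝ) : ℂ)) * (p.2 + ((δ / 2 : ℝ) : ℂ)) +
        ((14 * c : ℝ) : ℂ) * (p.2 + ((δ / 2 : ℝ) : ℂ)) ^ 2)) := fun r _ =>
      ((summable_norm_binTheta ha' (by rw [hD']; norm_num) _ _ _ _ hz).of_norm).mul_left _
    unfold binTheta
    simp_rw [← tsum_mul_left]
    rw [← Summable.tsum_finsetSum hs, ← tsum_mul_left, charTheta_eq]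
    refine tsum_congr fun p => ?_
    have h1 : ∀ r ∈ Finset.range 7, g r *
        cexp (2 * Real.pi * I * (((ε / 2 + r / (7 : ℕ) : ℝ) : ℂ) * p.1 + ((0 : ℝ) : ℂ) * p.2) +
        Real.pi * I * z * ((a : ℝ) * (p.1 + ((0 : ℝ) : ℂ)) ^ 2 + 2 * ((14 * b : ℝ) : ℂ) *
        (p.1 + ((0 : ℝ) : ℂ)) * (p.2 + ((δ / 2 : ℝ) : ℂ)) +
        ((14 * c : ℝ) : ℂ) * (p.2 + ((δ / 2 : ℝ) : ℂ)) ^ 2)) =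
        (cexp (2 * Real.pi * I * (-2 * c * r ^ 2) / 7) * cexp (2 * Real.pi * I * (r / 7) * p.1)) *
        cexp (Real.pi * I * ε * p.1 + Real.pi * I * z * (a * p.1 ^ 2 + 2 * (14 * b) * p.1 *
          (p.2 + δ / 2) + 14 * c * (p.2 + δ / 2) ^ 2)) := by
      intro r _
      rw [hg', ← Complex.exp_add, ← Complex.exp_add, ← Complex.exp_add]
      congr 1
      push_cast
      ring
    have e4 : ∀ x A B : ℂ, x / G * (G * A * B) = x * A * B := by intros; field_simp
    rw [Finset.sum_congr rfl h1, ← Finset.sum_mul, hG, e4, ← Complex.exp_add,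
      ← Complex.exp_add]
    refine cexp_congr (4 * b * p.1 * p.2 + 2 * b * p.1 * δ + 2 * c * p.2 ^ 2 + 2 * c * p.2 * δ) ?_
    push_cast
    ring
  rw [hsplit, key, hD']
  have e1 : cexp (-2 * Real.pi * I * ((0 : ℝ) : ℂ) * ((δ / 2 : ℝ) : ℂ)) = 1 := by simp
  have e2 : cexp (Real.pi * I * (c * (δ ^ 2 - 5 * ε ^ 2))) =
      cexp (Real.pi * I * (c * δ ^ 2)) * cexp (Real.pi * I * (-5 * c * ε ^ 2)) := by
    rw [← Complex.exp_add]; congr 1; ring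
  rw [e1, mul_one, e2, charTheta_eq]
  have e3 : ∀ x y w G T S : ℂ, T = y * S → x / G * (w * T) = x * y / G * w * S := by
    rintro x y w G T S rfl; ring
  apply e3
  -- In units of 1/7 the characteristic ε/2 is 7ε/2; moving the index by -3ε leaves the shift ε/2.
  rw [← ((Equiv.refl ℤ).prodCongr (Equiv.addRight (-3 * ε))).tsum_eq, ← tsum_mul_left]
  refine tsum_congr fun p => ?_
  rw [hg', ← Complex.exp_add, ← Complex.exp_add]
  refine cexp_congr (-δ * p.1 + a * p.1 ^ 2 - 4 * b * p.1 * p.2 - 2 * b * p.1 * ε +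
    2 * c * p.2 * ε) ?_
  simp only [Equiv.prodCongr_apply, Prod.map, Equiv.refl_apply, Equiv.coe_addRight]
  push_cast
  rw [hD'']
  field_simp
  ring

/-- The modulo 2 analogue. As a ≡ 1 mod 4, translation by 1/2 contributes exp(πi x²/2), a
combination of 1 and (-1)^x with coefficients `g 0` and `g 1`. As c is odd, the term in y
contributes (-1)^(y(1 + δ)), which turns δ into 1 - δ. The cross term contributes (-1)^(bδx), whence
the extra bδ/2 in the first characteristic. The hypothesis on κ rewrites the coefficient as one
quadratic phase, which the dual theta absorbs as its own translation by 1/2. -/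
lemma charTheta_half {a b c : ℤ} (ha : 0 < a) (ha4 : a % 4 = 1) (hc : Odd c)
    (hD : a * c - 14 * b ^ 2 = 1) {ε δ : ℤ} (hδ : δ ^ 2 = δ) {κ : ℂ}
    (hκ : ∀ n : ℤ, (1 + cexp (Real.pi * I * n) * I) / 2 =
      κ * cexp (Real.pi * I * (ε * (n + ε + b * δ) + 7 * c * (n + ε + b * δ) ^ 2 / 2 -
        7 * b * (n + ε + b * δ) * (1 - δ)))) {z : ℂ} (hz : 0 < z.im) :
    charTheta a (14 * b) (14 * c) ε δ (1 / 2 + z) =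
      κ * cexp (Real.pi * I * (7 * c * δ ^ 2 - a * (1 - δ) ^ 2) / 4) *
        (I / (z * Real.sqrt 14)) *
        charTheta (7 * c) (-(14 * b)) (2 * a) ε (1 - δ) (1 / 2 - 1 / (28 * z)) := by
  have hz0 : z ≠ 0 := by rintro rfl; simp at hz
  have ha' : (0 : ℝ) < a := by exact_mod_cast ha
  have hDR : (a * c - 14 * b ^ 2 : ℝ) = 1 := by exact_mod_cast hD
  have hD' : (a * (14 * c) - (14 * b) ^ 2 : ℝ) = 14 := by linear_combination 14 * hDR
  have hD'' : (a * (14 * c) - (14 * b) ^ 2 : ℂ) = 14 := by exact_mod_cast hD'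
  have hδC : (δ : ℂ) ^ 2 = δ := by exact_mod_cast hδ
  obtain ⟨a', rfl⟩ : ∃ a', a = 4 * a' + 1 := ⟨a / 4, by omega⟩
  obtain ⟨c', rfl⟩ := hc
  set g : ℤ → ℂ := fun n => (1 + cexp (Real.pi * I * n) * I) / 2 with hgdef
  have hg' : ∀ n : ℤ, g n = (1 + cexp (Real.pi * I * n) * I) / 2 := fun _ => rfl
  have hg : ∀ m n : ℤ, g ((2 : ℕ) * m + n) = g n := by
    intro m n
    rw [hg', hg']
    congr 3
    refine cexp_congr m ?_
    push_cast
    ring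
  have key := sum_binTheta_poisson (a := (4 * a' + 1 : ℤ)) (b := 14 * b) (c := 14 * (2 * c' + 1 : ℤ))
    ha' (by rw [hD']; norm_num) (ε / 2 + b * δ / 2) ((1 - δ) / 2) (δ / 2) hz (N := 2) (by norm_num) g hg
  have hsplit : charTheta (4 * a' + 1) (14 * b) (14 * (2 * c' + 1)) ε δ (1 / 2 + z) =
      cexp (Real.pi * I * (7 * (2 * c' + 1) * δ ^ 2) / 4) * ∑ r ∈ Finset.range 2, g r *
        binTheta (4 * a' + 1 : ℤ) (14 * b) (14 * (2 * c' + 1 : ℤ))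
          (ε / 2 + b * δ / 2 + r / (2 : ℕ)) ((1 - δ) / 2) 0 (δ / 2) z := by
    have hs := fun r : ℕ => (summable_norm_binTheta (a := (4 * a' + 1 : ℤ)) (b := 14 * b)
      (c := 14 * (2 * c' + 1 : ℤ)) ha' (by rw [hD']; norm_num)
      (ε / 2 + b * δ / 2 + r / (2 : ℕ)) ((1 - δ) / 2) 0 (δ / 2) hz).of_norm.mul_left (g r)
    unfold binTheta
    simp_rw [← tsum_mul_left]
    rw [← Summable.tsum_finsetSum (fun r _ => hs r), ← tsum_mul_left, charTheta_eq]
    refine tsum_congr fun p => ?_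
    -- The left side is 1 for even x and i for odd x, and `g 0`, `g 1` are (1 + i)/2 and (1 - i)/2.
    have hquad : cexp (Real.pi * I * p.1 ^ 2 / 2) = g 0 + g 1 * cexp (Real.pi * I * p.1) := by
      rw [hg', hg']
      rcases Int.even_or_odd' p.1 with ⟨m, hm | hm⟩
      · have e1 : cexp (Real.pi * I * p.1 ^ 2 / 2) = 1 := by
          rw [← Complex.exp_zero]
          exact cexp_congr (m ^ 2) (by rw [hm]; push_cast; ring)
        have e2 : cexp (Real.pi * I * p.1) = 1 := by
          rw [← Complex.exp_zero]
          exact cexp_congr m (by rw [hm]; push_cast; ring)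
        rw [e1, e2]
        simp
        ring
      · have e1 : cexp (Real.pi * I * p.1 ^ 2 / 2) = I := by
          refine Eq.trans ?_ Complex.exp_pi_div_two_mul_I
          exact cexp_congr (m ^ 2 + m) (by rw [hm]; push_cast; ring)
        have e2 : cexp (Real.pi * I * p.1) = -1 := by
          rw [← Complex.exp_pi_mul_I]
          exact cexp_congr m (by rw [hm]; push_cast; ring)
        rw [e1, e2]
        simp
        ring
    rw [Finset.sum_range_succ, Finset.sum_range_one]
    have h1 : cexp (Real.pi * I * ε * p.1 + Real.pi * I * (1 / 2 + z) *
        ((4 * a' + 1 : ℤ) * p.1 ^ 2 + 2 * (14 * b : ℤ) * p.1 * (p.2 + δ / 2) +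
          (14 * (2 * c' + 1) : ℤ) * (p.2 + δ / 2) ^ 2)) =
        cexp (Real.pi * I * (7 * (2 * c' + 1) * δ ^ 2) / 4) * (cexp (Real.pi * I * p.1 ^ 2 / 2) *
        cexp (2 * Real.pi * I * ((ε / 2 + b * δ / 2) * p.1 + (1 - δ) / 2 * p.2) +
          Real.pi * I * z * ((4 * a' + 1) * p.1 ^ 2 + 2 * (14 * b) *
          p.1 * (p.2 + δ / 2) + 14 * (2 * c' + 1) * (p.2 + δ / 2) ^ 2))) := by
      obtain ⟨m, hm⟩ := Int.even_mul_pred_self p.2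
      have hm' : (p.2 * (p.2 - 1) : ℂ) = m + m := by exact_mod_cast hm
      rw [← Complex.exp_add, ← Complex.exp_add]
      refine cexp_congr (a' * p.1 ^ 2 + 7 * b * p.1 * p.2 + 3 * b * p.1 * δ + 7 * m + 3 * p.2
        + 7 * c' * p.2 ^ 2 + 7 * c' * p.2 * δ + 4 * p.2 * δ) ?_
      push_cast
      linear_combination (7 * Real.pi * I) * hm'
    rw [h1, hquad]
    congr 1
    rw [add_mul]
    congr 1
    · congr 2
      push_cast
      ring
    · rw [mul_assoc, ← Complex.exp_add]
      congr 2
      push_cast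
      ring
  rw [hsplit, key, hD']
  -- The phase involves δ(1 - δ), which is 0 because δ² = δ.
  have e1 : cexp (-2 * Real.pi * I * (((1 - δ) / 2 : ℝ) : ℂ) * ((δ / 2 : ℝ) : ℂ)) = 1 := by
    rw [← Complex.exp_zero]
    congr 1
    push_cast
    linear_combination (Real.pi * I / 2) * hδC
  have e2 : cexp (Real.pi * I * (7 * (2 * c' + 1 : ℤ) * δ ^ 2 - (4 * a' + 1 : ℤ) * (1 - δ) ^ 2) / 4) =
      cexp (Real.pi * I * (7 * (2 * c' + 1) * δ ^ 2) / 4) *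
        cexp (-(Real.pi * I * ((4 * a' + 1) * (1 - δ) ^ 2) / 4)) := by
    rw [← Complex.exp_add]; congr 1; push_cast; ring
  rw [e1, mul_one, e2, charTheta_eq]
  have e3 : ∀ x y w k T S : ℂ, T = k * y * S → x * (w * T) = k * (x * y) * w * S := by
    rintro x y w G T S rfl; ring
  apply e3
  rw [← (Equiv.prodComm ℤ ℤ).tsum_eq,
    ← ((Equiv.addRight (-(ε + b * δ))).prodCongr (Equiv.refl ℤ)).tsum_eq, ← tsum_mul_left]
  refine tsum_congr fun p => ?_
  simp only [Equiv.prodCongr_apply, Prod.map, Equiv.refl_apply, Equiv.coe_addRight,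
    Equiv.prodComm_apply, Prod.swap_prod_mk]
  rw [hg', hκ, mul_assoc κ, mul_assoc κ, ← Complex.exp_add, ← Complex.exp_add]
  congr 1
  obtain ⟨m, hm⟩ := Int.even_mul_pred_self p.2
  have hm' : (p.2 * (p.2 - 1) : ℂ) = m + m := by exact_mod_cast hm
  refine cexp_congr (7 * b * p.1 * p.2 - (4 * a' + 1) * (m + p.2) + 2 * a' * δ * p.2) ?_
  push_cast at hD'' ⊢
  rw [hD'']
  linear_combination (-(4 * a' + 1) * Real.pi * I) * hm'

/-- The involution at 2/7 sends the class of C to this form. The unimodular substitution back is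
made affine by δ so as to respect the half-integral shift; this produces the sign (-1)^(εδ). -/
lemma charTheta_35_14_6 (ε δ : ℤ) (τ : ℂ) :
    charTheta 35 14 6 ε δ τ = cexp (Real.pi * I * (ε * δ)) * charTheta 5 (-14) 42 ε δ τ := by
  rw [charTheta_eq, charTheta_eq, ← tsum_mul_left]
  let e : ℤ × ℤ ≃ ℤ × ℤ :=
    { toFun := fun p => (-p.1 + 2 * p.2 + δ, 3 * p.1 - 7 * p.2 - 4 * δ)
      invFun := fun p => (-(2 * p.2 + δ + 7 * p.1), -(p.2 + δ + 3 * p.1))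
      left_inv := fun p => by ext <;> simp <;> ring
      right_inv := fun p => by ext <;> simp <;> ring }
  rw [← e.tsum_eq]
  refine tsum_congr fun p => ?_
  rw [← Complex.exp_add]
  refine cexp_congr (ε * (p.2 - p.1)) ?_
  simp only [e, Equiv.coe_fn_mk]
  push_cast
  ring

/-- The same for the form produced by the involution at 1/2; here the substitution changes the
character exponent by an even integer. -/
lemma charTheta_21_14_10 (ε δ : ℤ) (τ : ℂ) :
    charTheta 21 14 10 ε δ τ = charTheta 5 (-14) 42 ε δ τ := by
  rw [charTheta_eq, charTheta_eq]
  let e : ℤ × ℤ ≃ ℤ × ℤ :=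
    { toFun := fun p => (4 * p.2 + 2 * δ - p.1, 2 * p.1 - 7 * p.2 - 4 * δ)
      invFun := fun p => (7 * p.1 + 4 * p.2 + 2 * δ, 2 * p.1 + p.2)
      left_inv := fun p => by ext <;> simp <;> ring
      right_inv := fun p => by ext <;> simp <;> ring }
  rw [← e.tsum_eq]
  refine tsum_congr fun p => ?_
  refine cexp_congr (ε * (2 * p.2 + δ - p.1)) ?_
  simp only [e, Equiv.coe_fn_mk]
  push_cast
  ring

/-! ### Quadratic Gauss sums modulo 7 -/

lemma sum_zmod_seven (f : ZMod 7 → ℂ) :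
    ∑ r, f r = f 0 + f 1 + f 2 + f 3 + f 4 + f 5 + f 6 := Fin.sum_univ_seven f

lemma sum_range_seven (f : ZMod 7 → ℂ) : ∑ r ∈ Finset.range 7, f (r : ZMod 7) = ∑ r, f r := by
  rw [sum_zmod_seven]
  simp [Finset.sum_range_succ]

/-- Quadratic Gauss sums modulo `7`. -/
lemma gaussSum_seven_phase {a c : ℤ} (h : (a * c) % 7 = 1) (x : ℤ) :
    ∑ r ∈ Finset.range 7, cexp (2 * Real.pi * I * (-2 * c * r ^ 2) / 7) *
      cexp (2 * Real.pi * I * (r / 7) * x) =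
    (∑ r : ZMod 7, ZMod.stdAddChar (-2 * (c : ZMod 7) * r ^ 2)) * cexp (2 * Real.pi * I * a * x ^ 2 / 7) := by
  have hac : (a * c : ZMod 7) = 1 := by
    have : ((a * c : ℤ) : ZMod 7) = ((1 : ℤ) : ZMod 7) :=
      (ZMod.intCast_eq_intCast_iff' _ _ 7).2 (by push_cast; omega)
    exact_mod_cast this
  have e : ∀ n : ℤ, ∀ w : ℂ, w = 2 * Real.pi * I * n / 7 →
      cexp w = ZMod.stdAddChar ((n : ℤ) : ZMod 7) := by
    intro n w hw
    rw [ZMod.stdAddChar_coe, hw]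
    push_cast
    rfl
  have h7 : (7 : ZMod 7) = 0 := rfl
  have h1 : ∀ r ∈ Finset.range 7, cexp (2 * Real.pi * I * (-2 * c * r ^ 2) / 7) *
      cexp (2 * Real.pi * I * (r / 7) * x) =
      (fun r : ZMod 7 => ZMod.stdAddChar (-2 * (c : ZMod 7) * r ^ 2 + r * (x : ZMod 7))) (r : ZMod 7) := by
    intro r _
    rw [← Complex.exp_add, e (-2 * c * r ^ 2 + r * x) _ (by push_cast; ring)]
    push_cast
    rfl
  refine (Finset.sum_congr rfl h1).trans ((sum_range_seven (fun r : ZMod 7 =>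
    (ZMod.stdAddChar (-2 * (c : ZMod 7) * r ^ 2 + r * (x : ZMod 7)) : ℂ))).trans ?_)
  rw [e (a * x ^ 2) _ (by push_cast; ring), Finset.sum_mul]
  -- The shift 2ax completes the square: since ac = 1, the terms linear in r add up to -7rx = 0 and
  -- the constant is -6ax² = ax².
  rw [← Equiv.sum_comp (Equiv.addRight (2 * (a : ZMod 7) * (x : ZMod 7))) (fun r : ZMod 7 => (ZMod.stdAddChar (-2 * (c : ZMod 7) * r ^ 2 + r * (x : ZMod 7)) : ℂ))]
  refine Finset.sum_congr rfl fun r _ => ?_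
  rw [← AddChar.map_add_eq_mul]
  congr 1
  simp only [Equiv.coe_addRight]
  push_cast
  linear_combination (-8 * a * x ^ 2 - 8 * r * x) * hac + (-r*x- a*x^2) * h7

lemma stdAddChar_seven (n : ℕ) (x : ZMod 7) (h : x = n) :
    (ZMod.stdAddChar x : ℂ) = ZMod.stdAddChar (1 : ZMod 7) ^ n := by
  rw [h, ← AddChar.map_nsmul_eq_pow, nsmul_one]

lemma stdAddChar_seven_relation : let ζ : ℂ := ZMod.stdAddChar (1 : ZMod 7)
    1 + ζ + ζ ^ 2 + ζ ^ 3 + ζ ^ 4 + ζ ^ 5 + ζ ^ 6 = 0 := by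
  intro ζ
  have h := AddChar.sum_eq_zero_of_ne_one (ψ := (ZMod.stdAddChar : AddChar (ZMod 7) ℂ))
    (by
      intro h
      have := ZMod.injective_stdAddChar (N := 7) (a₁ := 1) (a₂ := 0) (by rw [h]; simp)
      exact absurd this (by decide))
  rw [sum_zmod_seven] at h
  rw [stdAddChar_seven 0 0 rfl, stdAddChar_seven 1 1 rfl, stdAddChar_seven 2 2 rfl,
    stdAddChar_seven 3 3 rfl, stdAddChar_seven 4 4 rfl, stdAddChar_seven 5 5 rfl,
    stdAddChar_seven 6 6 rfl] at h
  simpa [ζ] using h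

lemma gaussSum_seven_one : ∑ r : ZMod 7, (ZMod.stdAddChar (-2 * ((1 : ℤ) : ZMod 7) * r ^ 2) : ℂ) =
    let ζ : ℂ := ZMod.stdAddChar (1 : ZMod 7)
    1 + 2 * (ζ ^ 3 + ζ ^ 5 + ζ ^ 6) := by
  rw [sum_zmod_seven]
  rw [stdAddChar_seven 0 (-2 * ((1 : ℤ) : ZMod 7) * 0 ^ 2) (by decide),
    stdAddChar_seven 5 (-2 * ((1 : ℤ) : ZMod 7) * 1 ^ 2) (by decide),
    stdAddChar_seven 6 (-2 * ((1 : ℤ) : ZMod 7) * 2 ^ 2) (by decide),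
    stdAddChar_seven 3 (-2 * ((1 : ℤ) : ZMod 7) * 3 ^ 2) (by decide),
    stdAddChar_seven 3 (-2 * ((1 : ℤ) : ZMod 7) * 4 ^ 2) (by decide),
    stdAddChar_seven 6 (-2 * ((1 : ℤ) : ZMod 7) * 5 ^ 2) (by decide),
    stdAddChar_seven 5 (-2 * ((1 : ℤ) : ZMod 7) * 6 ^ 2) (by decide)]
  ring

/-- 3 is a non-residue modulo 7. This sign is what separates C from A and B under the involution at
2/7. -/
lemma gaussSum_seven_three : ∑ r : ZMod 7, (ZMod.stdAddChar (-2 * ((3 : ℤ) : ZMod 7) * r ^ 2) : ℂ) =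
    -∑ r : ZMod 7, (ZMod.stdAddChar (-2 * ((1 : ℤ) : ZMod 7) * r ^ 2) : ℂ) := by
  rw [gaussSum_seven_one, sum_zmod_seven]
  rw [stdAddChar_seven 0 (-2 * ((3 : ℤ) : ZMod 7) * 0 ^ 2) (by decide),
    stdAddChar_seven 1 (-2 * ((3 : ℤ) : ZMod 7) * 1 ^ 2) (by decide),
    stdAddChar_seven 4 (-2 * ((3 : ℤ) : ZMod 7) * 2 ^ 2) (by decide),
    stdAddChar_seven 2 (-2 * ((3 : ℤ) : ZMod 7) * 3 ^ 2) (by decide),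
    stdAddChar_seven 2 (-2 * ((3 : ℤ) : ZMod 7) * 4 ^ 2) (by decide),
    stdAddChar_seven 4 (-2 * ((3 : ℤ) : ZMod 7) * 5 ^ 2) (by decide),
    stdAddChar_seven 1 (-2 * ((3 : ℤ) : ZMod 7) * 6 ^ 2) (by decide)]
  linear_combination 2 * stdAddChar_seven_relation

lemma gaussSum_seven_mul_conj :
    (∑ r : ZMod 7, (ZMod.stdAddChar (-2 * ((1 : ℤ) : ZMod 7) * r ^ 2) : ℂ)) *
    starRingEnd ℂ (∑ r : ZMod 7, (ZMod.stdAddChar (-2 * ((1 : ℤ) : ZMod 7) * r ^ 2) : ℂ)) = 7 := by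
  have hrel := stdAddChar_seven_relation
  have h7 : (ZMod.stdAddChar (1 : ZMod 7) : ℂ) ^ 7 = 1 := by
    rw [← stdAddChar_seven 7 0 rfl, AddChar.map_zero_eq_one]
  have hconj : starRingEnd ℂ (ZMod.stdAddChar (1 : ZMod 7) : ℂ) = ZMod.stdAddChar (1 : ZMod 7) ^ 6 := by
    rw [← stdAddChar_seven 6 (-1) (by decide)]
    exact (AddChar.map_neg_eq_conj _ _).symm
  rw [gaussSum_seven_one]
  dsimp only at hrel ⊢
  simp only [map_add, map_mul, map_pow, hconj, map_one, map_ofNat]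
  generalize (ZMod.stdAddChar (1 : ZMod 7) : ℂ) = ζ at *
  have e1 : (ζ ^ 6) ^ 3 = ζ ^ 4 := by linear_combination (ζ ^ 11 + ζ ^ 4) * h7
  have e2 : (ζ ^ 6) ^ 5 = ζ ^ 2 := by linear_combination (ζ ^ 23 + ζ ^ 16 + ζ ^ 9 + ζ ^ 2) * h7
  have e3 : (ζ ^ 6) ^ 6 = ζ := by
    linear_combination (ζ ^ 29 + ζ ^ 22 + ζ ^ 15 + ζ ^ 8 + ζ) * h7
  rw [e1, e2, e3]
  linear_combination 6 * hrel + (12 + 4 * ζ + 4 * ζ ^ 2 + 4 * ζ ^ 3) * h7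

/-! ### Transformation laws of the three theta functions -/

/-- Theta functions of the form `(1, 0, 14)`. -/
noncomputable def thetaA (ε δ : ℤ) (τ : ℂ) : ℂ := charTheta 1 0 14 ε δ τ

/-- Theta functions of the form `(7, 0, 2)`. -/
noncomputable def thetaB (ε δ : ℤ) (τ : ℂ) : ℂ := charTheta 7 0 2 ε δ τ

/-- Theta functions of the form `(5, -28, 42)`, which is equivalent to `(3, 2, 5)`. -/
noncomputable def thetaC (ε δ : ℤ) (τ : ℂ) : ℂ := charTheta 5 (-14) 42 ε δ τ

lemma cexp_eq_one_of {z : ℂ} (m : ℤ) (h : z = Real.pi * I * (2 * m)) : cexp z = 1 := by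
  rw [← Complex.exp_zero]
  exact cexp_congr m (by rw [h]; ring)

lemma cexp_eq_neg_one_of {z : ℂ} (m : ℤ) (h : z = Real.pi * I * (2 * m + 1)) : cexp z = -1 := by
  rw [← Complex.exp_pi_mul_I]
  exact cexp_congr m (by rw [h]; ring)

lemma cexp_eq_I_of {z : ℂ} (m : ℤ) (h : z = Real.pi * I * (2 * m + 1 / 2)) : cexp z = I := by
  refine Eq.trans ?_ Complex.exp_pi_div_two_mul_I
  exact cexp_congr m (by rw [h]; ring)

lemma cexp_eq_neg_I_of {z : ℂ} (m : ℤ) (h : z = Real.pi * I * (2 * m - 1 / 2)) : cexp z = -I := by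
  refine Eq.trans ?_ Complex.exp_neg_pi_div_two_mul_I
  exact cexp_congr m (by rw [h]; ring)

section translation

variable (ε : ℤ) (τ : ℂ)

lemma thetaA_add_one_zero : thetaA ε 0 (τ + 1) = thetaA (1 - ε) 0 τ := by
  unfold thetaA
  rw [charTheta_add_one (by decide) (by decide) (by decide)]
  simp

lemma thetaB_add_one_zero : thetaB ε 0 (τ + 1) = thetaB (1 - ε) 0 τ := by
  unfold thetaB
  rw [charTheta_add_one (by decide) (by decide) (by decide)]
  simp

lemma thetaC_add_one_zero : thetaC ε 0 (τ + 1) = thetaC (1 - ε) 0 τ := by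
  unfold thetaC
  rw [charTheta_add_one (by decide) (by decide) (by decide)]
  simp

lemma thetaA_add_one_one : thetaA ε 1 (τ + 1) = -I * thetaA (1 - ε) 1 τ := by
  unfold thetaA
  rw [charTheta_add_one (by decide) (by decide) (by decide),
    cexp_eq_neg_I_of 2 (by push_cast; ring)]

lemma thetaB_add_one_one : thetaB ε 1 (τ + 1) = I * thetaB (1 - ε) 1 τ := by
  unfold thetaB
  rw [charTheta_add_one (by decide) (by decide) (by decide),
    cexp_eq_I_of 0 (by push_cast; ring)]

lemma thetaC_add_one_one : thetaC ε 1 (τ + 1) = I * thetaC (1 - ε) 1 τ := by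
  unfold thetaC
  rw [charTheta_add_one (by decide) (by decide) (by decide),
    cexp_eq_I_of 5 (by push_cast; ring)]

end translation

section fricke

variable (ε δ : ℤ) {τ : ℂ} (hτ : 0 < τ.im)
include hτ

lemma thetaA_inv : thetaA ε δ τ = I / (τ * Real.sqrt 14) * thetaA δ ε (-1 / (14 * τ)) :=
  charTheta_inv (by norm_num) (by norm_num) ε δ hτ

lemma thetaB_inv : thetaB ε δ τ = I / (τ * Real.sqrt 14) * thetaB δ ε (-1 / (14 * τ)) :=
  charTheta_inv (by norm_num) (by norm_num) ε δ hτ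

lemma thetaC_inv : thetaC ε δ τ = I / (τ * Real.sqrt 14) * thetaC δ ε (-1 / (14 * τ)) :=
  charTheta_inv (by norm_num) (by norm_num) ε δ hτ

end fricke

lemma im_neg_inv_pos {z : ℂ} (hz : 0 < z.im) {M : ℝ} (hM : 0 < M) : 0 < (-(1 / (M * z))).im := by
  have hz0 : z ≠ 0 := by rintro rfl; simp at hz
  have : 0 < normSq z := normSq_pos.2 hz0
  rw [one_div, mul_inv, ← ofReal_inv, neg_im, im_ofReal_mul, inv_im]
  have h2 : 0 < M⁻¹ := by positivity
  have h3 : 0 < z.im / normSq z := by positivity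
  rw [neg_div]
  nlinarith [mul_pos h2 h3]

/-- The constant occurring in the involution with fixed point on `re τ = 1 / 2`. -/
noncomputable def halfConst (ε : ℤ) : ℂ := (1 + (1 - 2 * ε) * I) / 2 * cexp (-(Real.pi * I / 4))

lemma cexp_neg_pi_div_four_sq : cexp (-(Real.pi * I / 4)) ^ 2 = -I := by
  rw [← Complex.exp_nat_mul]
  exact cexp_eq_neg_I_of 0 (by push_cast; ring)

lemma halfConst_zero_sq : halfConst 0 ^ 2 = 1 / 2 := by
  unfold halfConst
  rw [mul_pow, cexp_neg_pi_div_four_sq]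
  push_cast
  linear_combination (-1 / 2 - I / 4) * I_sq

lemma halfConst_one_sq : halfConst 1 ^ 2 = -1 / 2 := by
  unfold halfConst
  rw [mul_pow, cexp_neg_pi_div_four_sq]
  push_cast
  linear_combination (1 / 2 - I / 4) * I_sq

section half

variable {z : ℂ} (hz : 0 < z.im)
include hz

lemma thetaA_half {ε δ : ℤ} (hε : ε = 0 ∨ ε = 1) (hδ : δ = 0 ∨ δ = 1) :
    thetaA ε δ (1 / 2 + z) = halfConst ε * (I / (z * Real.sqrt 14)) *
      thetaB ε (1 - δ) (1 / 2 - 1 / (28 * z)) := by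
  have h := charTheta_half (a := 1) (b := 0) (c := 1) (by norm_num) (by norm_num) (by decide)
    (by norm_num) (ε := ε) (δ := δ) (by rcases hδ with rfl | rfl <;> norm_num)
    (κ := (1 + (1 - 2 * ε) * I) / 2) (by
      intro n
      rcases Int.even_or_odd' n with ⟨m, rfl | rfl⟩ <;> rcases hε with rfl | rfl
      · rw [cexp_eq_one_of m (by push_cast; ring), cexp_eq_one_of (7 * m ^ 2) (by push_cast; ring)]
        push_cast; ring
      · rw [cexp_eq_one_of m (by push_cast; ring),
          cexp_eq_I_of (7 * m ^ 2 + 8 * m + 2) (by push_cast; ring)]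
        push_cast; linear_combination (1 / 2) * I_sq
      · rw [cexp_eq_neg_one_of m (by push_cast; ring),
          cexp_eq_neg_I_of (7 * m ^ 2 + 7 * m + 2) (by push_cast; ring)]
        push_cast; linear_combination (1 / 2) * I_sq
      · rw [cexp_eq_neg_one_of m (by push_cast; ring),
          cexp_eq_one_of (7 * m ^ 2 + 15 * m + 8) (by push_cast; ring)]
        push_cast; ring) hz
  have e : cexp (Real.pi * I * (7 * (1 : ℤ) * δ ^ 2 - (1 : ℤ) * (1 - δ) ^ 2) / 4) =
      cexp (-(Real.pi * I / 4)) := by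
    rcases hδ with rfl | rfl
    · exact cexp_congr 0 (by push_cast; ring)
    · exact cexp_congr 1 (by push_cast; ring)
  rw [e] at h
  exact h

/-- This is `thetaA_half` read backwards: z ↦ -1/(28z) is an involution, and the constants of the
two directions multiply to 1. -/
lemma thetaB_half {ε δ : ℤ} (hε : ε = 0 ∨ ε = 1) (hδ : δ = 0 ∨ δ = 1) :
    thetaB ε δ (1 / 2 + z) = (1 - 2 * ε) * halfConst ε * (I / (z * Real.sqrt 14)) *
      thetaA ε (1 - δ) (1 / 2 - 1 / (28 * z)) := by
  have hz0 : z ≠ 0 := by rintro rfl; simp at hz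
  have hz' : 0 < (-(1 / (28 * z))).im := by
    have := im_neg_inv_pos hz (M := 28) (by norm_num)
    exact_mod_cast this
  have hδ' : 1 - δ = 0 ∨ 1 - δ = 1 := by omega
  have h := thetaA_half hz' hε hδ'
  have e1 : (1 / 2 - 1 / (28 * -(1 / (28 * z))) : ℂ) = 1 / 2 + z := by field_simp; ring
  have e2 : (1 / 2 + -(1 / (28 * z)) : ℂ) = 1 / 2 - 1 / (28 * z) := by ring
  rw [e1, e2, sub_sub_cancel] at h
  rw [h]
  have h14 := sqrt_fourteen_sq
  have h14' : ((Real.sqrt 14 : ℝ) : ℂ) ≠ 0 := by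
    intro h0; rw [h0] at h14; norm_num at h14
  have hk : (1 - 2 * (ε : ℂ)) * halfConst ε ^ 2 = 1 / 2 := by
    rcases hε with rfl | rfl
    · rw [halfConst_zero_sq]; push_cast; ring
    · rw [halfConst_one_sq]; push_cast; ring
  generalize halfConst ε = H at *
  generalize ((Real.sqrt 14 : ℝ) : ℂ) = s at *
  have e3 : (1 - 2 * (ε : ℂ)) * H * (I / (z * s)) * (H * (I / (-(1 / (28 * z)) * s))) = 1 := by
    have : (1 - 2 * (ε : ℂ)) * H * (I / (z * s)) * (H * (I / (-(1 / (28 * z)) * s))) =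
        (1 - 2 * (ε : ℂ)) * H ^ 2 * (-28 * I ^ 2 / s ^ 2) := by
      field_simp
    rw [this, hk, h14, I_sq]; norm_num
  rw [← mul_assoc, e3, one_mul]

lemma thetaC_half {ε δ : ℤ} (hε : ε = 0 ∨ ε = 1) (hδ : δ = 0 ∨ δ = 1) :
    thetaC ε δ (1 / 2 + z) = -(1 - 2 * ε * δ) * halfConst ε * (I / (z * Real.sqrt 14)) *
      thetaC ε (1 - δ) (1 / 2 - 1 / (28 * z)) := by
  have h := charTheta_half (a := 5) (b := -1) (c := 3) (by norm_num) (by norm_num) (by decide)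
    (by norm_num) (ε := ε) (δ := δ) (by rcases hδ with rfl | rfl <;> norm_num)
    (κ := (1 + (1 - 2 * ε) * (1 - 2 * δ) * I) / 2) (by
      intro n
      rcases Int.even_or_odd' n with ⟨m, rfl | rfl⟩ <;> rcases hε with rfl | rfl <;>
        rcases hδ with rfl | rfl
      · rw [cexp_eq_one_of m (by push_cast; ring),
          cexp_eq_one_of (21 * m ^ 2 + 7 * m) (by push_cast; ring)]
        push_cast; ring
      · rw [cexp_eq_one_of m (by push_cast; ring),
          cexp_eq_I_of (21 * m ^ 2 - 21 * m + 5) (by push_cast; ring)]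
        push_cast; linear_combination (1 / 2) * I_sq
      · rw [cexp_eq_one_of m (by push_cast; ring),
          cexp_eq_I_of (21 * m ^ 2 + 29 * m + 9) (by push_cast; ring)]
        push_cast; linear_combination (1 / 2) * I_sq
      · rw [cexp_eq_one_of m (by push_cast; ring),
          cexp_eq_one_of (21 * m ^ 2 + m) (by push_cast; ring)]
        push_cast; ring
      · rw [cexp_eq_neg_one_of m (by push_cast; ring),
          cexp_eq_neg_I_of (21 * m ^ 2 + 28 * m + 9) (by push_cast; ring)]
        push_cast; linear_combination (1 / 2) * I_sq
      · rw [cexp_eq_neg_one_of m (by push_cast; ring),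
          cexp_eq_one_of (21 * m ^ 2) (by push_cast; ring)]
        push_cast; ring
      · rw [cexp_eq_neg_one_of m (by push_cast; ring),
          cexp_eq_one_of (21 * m ^ 2 + 50 * m + 29) (by push_cast; ring)]
        push_cast; ring
      · rw [cexp_eq_neg_one_of m (by push_cast; ring),
          cexp_eq_neg_I_of (21 * m ^ 2 + 22 * m + 6) (by push_cast; ring)]
        push_cast; linear_combination (1 / 2) * I_sq) hz
  have e : (1 + (1 - 2 * ε) * (1 - 2 * δ) * I) / 2 *
      cexp (Real.pi * I * (7 * (3 : ℤ) * δ ^ 2 - (5 : ℤ) * (1 - δ) ^ 2) / 4) =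
      -(1 - 2 * ε * δ) * halfConst ε := by
    unfold halfConst
    rcases hδ with rfl | rfl
    · have : cexp (Real.pi * I * (7 * (3 : ℤ) * (0 : ℤ) ^ 2 - (5 : ℤ) * (1 - (0 : ℤ)) ^ 2) / 4) =
          -1 * cexp (-(Real.pi * I / 4)) := by
        rw [← Complex.exp_pi_mul_I, ← Complex.exp_add]
        exact cexp_congr (-1) (by push_cast; ring)
      rw [this]; push_cast; ring
    · have : cexp (Real.pi * I * (7 * (3 : ℤ) * (1 : ℤ) ^ 2 - (5 : ℤ) * (1 - (1 : ℤ)) ^ 2) / 4) =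
          -I * cexp (-(Real.pi * I / 4)) := by
        rw [← cexp_eq_neg_I_of (z := -(Real.pi * I / 2)) 0 (by push_cast; ring), ← Complex.exp_add]
        exact cexp_congr 3 (by push_cast; ring)
      rw [this]
      rcases hε with rfl | rfl
      · push_cast; linear_combination (cexp (-(Real.pi * I / 4)) / 2) * I_sq
      · push_cast; linear_combination (-cexp (-(Real.pi * I / 4)) / 2) * I_sq
  rw [e] at h
  have h' := h.trans (congrArg _ (charTheta_21_14_10 ε (1 - δ) _))
  exact h'

end half

/-- The quadratic Gauss sum modulo `7` attached to the form `(1, 0, 14)`. -/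
noncomputable def gaussSeven : ℂ := ∑ r : ZMod 7, ZMod.stdAddChar (-2 * ((1 : ℤ) : ZMod 7) * r ^ 2)

lemma gaussSeven_mul_conj : gaussSeven * starRingEnd ℂ gaussSeven = 7 := gaussSum_seven_mul_conj

lemma gaussSeven_ne_zero : gaussSeven ≠ 0 := by
  intro h
  have := gaussSeven_mul_conj
  rw [h] at this
  norm_num at this

lemma cexp_sign_two_sevenths {c : ℤ} (hc : Odd c) {ε δ : ℤ} (hε : ε = 0 ∨ ε = 1)
    (hδ : δ = 0 ∨ δ = 1) :
    cexp (Real.pi * I * (c * (δ ^ 2 - 5 * ε ^ 2))) = (1 - 2 * ε) * (1 - 2 * δ) := by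
  obtain ⟨c, rfl⟩ := hc
  rcases hε with rfl | rfl <;> rcases hδ with rfl | rfl
  · rw [cexp_eq_one_of 0 (by push_cast; ring)]; push_cast; ring
  · rw [cexp_eq_neg_one_of c (by push_cast; ring)]; push_cast; ring
  · rw [cexp_eq_neg_one_of (-5 * c - 3) (by push_cast; ring)]; push_cast; ring
  · rw [cexp_eq_one_of (-4 * c - 2) (by push_cast; ring)]; push_cast; ring

section twoSevenths

variable {z : ℂ} (hz : 0 < z.im)
include hz

lemma thetaA_two_sevenths {ε δ : ℤ} (hε : ε = 0 ∨ ε = 1) (hδ : δ = 0 ∨ δ = 1) :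
    thetaA ε δ (2 / 7 + z) = (1 - 2 * ε) * (1 - 2 * δ) / gaussSeven * (I / (z * Real.sqrt 14)) *
      thetaB δ ε (-(2 / 7) - 1 / (98 * z)) := by
  have h := charTheta_two_sevenths (a := 1) (b := 0) (c := 1) (by norm_num) (by norm_num)
    gaussSeven_ne_zero (gaussSum_seven_phase (by norm_num)) ε δ hz
  rw [cexp_sign_two_sevenths (by decide) hε hδ] at h
  exact h

lemma thetaC_two_sevenths {ε δ : ℤ} (hε : ε = 0 ∨ ε = 1) (hδ : δ = 0 ∨ δ = 1) :
    thetaC ε δ (2 / 7 + z) = -(1 - 2 * ε * δ) * ((1 - 2 * ε) * (1 - 2 * δ)) / gaussSeven *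
      (I / (z * Real.sqrt 14)) * thetaC δ ε (-(2 / 7) - 1 / (98 * z)) := by
  have h := charTheta_two_sevenths (a := 5) (b := -1) (c := 3) (by norm_num) (by norm_num)
    (by rw [gaussSum_seven_three]; exact neg_ne_zero.2 gaussSeven_ne_zero)
    (gaussSum_seven_phase (by norm_num)) ε δ hz
  rw [cexp_sign_two_sevenths (by decide) hε hδ, gaussSum_seven_three] at h
  have h' := h.trans (congrArg _ (charTheta_35_14_6 δ ε _))
  have e : cexp (Real.pi * I * (δ * ε)) = 1 - 2 * ε * δ := by
    rcases hε with rfl | rfl <;> rcases hδ with rfl | rfl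
    · rw [cexp_eq_one_of 0 (by push_cast; ring)]; push_cast; ring
    · rw [cexp_eq_one_of 0 (by push_cast; ring)]; push_cast; ring
    · rw [cexp_eq_one_of 0 (by push_cast; ring)]; push_cast; ring
    · rw [cexp_eq_neg_one_of 0 (by push_cast; ring)]; push_cast; ring
  rw [e] at h'
  refine h'.trans ?_
  unfold thetaC gaussSeven
  rw [div_neg]
  ring

/-- Inverting `thetaA_two_sevenths` would put B at -2/7 rather than 2/7. The reflection τ ↦ -τ̄,
under which the thetas are conjugated, repairs the sign; the constants cancel because the Gauss sum
has squared modulus 7. -/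
lemma thetaB_two_sevenths {ε δ : ℤ} (hε : ε = 0 ∨ ε = 1) (hδ : δ = 0 ∨ δ = 1) :
    thetaB ε δ (2 / 7 + z) = (1 - 2 * ε) * (1 - 2 * δ) / gaussSeven * (I / (z * Real.sqrt 14)) *
      thetaA δ ε (-(2 / 7) - 1 / (98 * z)) := by
  have hz0 : z ≠ 0 := by rintro rfl; simp at hz
  have hz0' : starRingEnd ℂ z ≠ 0 := by simpa using hz0
  have hz' : 0 < (1 / (98 * starRingEnd ℂ z)).im := by
    have := im_neg_inv_pos hz (M := 98) (by norm_num)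
    have e : 1 / (98 * starRingEnd ℂ z) = starRingEnd ℂ (1 / ((98 : ℝ) * z)) := by
      simp only [map_div₀, map_mul, map_one, conj_ofReal]; norm_num
    rw [e, conj_im]; simpa using this
  have h := thetaA_two_sevenths hz' hδ hε
  have e1 : (2 / 7 + 1 / (98 * starRingEnd ℂ z) : ℂ) =
      -starRingEnd ℂ (-(2 / 7) - 1 / (98 * z)) := by
    simp only [map_sub, map_neg, map_div₀, map_mul, map_one, map_ofNat]; ring
  have e2 : (-(2 / 7) - 1 / (98 * (1 / (98 * starRingEnd ℂ z))) : ℂ) =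
      -starRingEnd ℂ (2 / 7 + z) := by
    simp only [map_add, map_div₀, map_ofNat]; field_simp; ring
  rw [e1, e2] at h
  unfold thetaA thetaB at h ⊢
  rw [charTheta_conj, charTheta_conj] at h
  have h2 := congrArg (starRingEnd ℂ) h
  simp only [map_mul, map_div₀, map_sub, map_one, map_ofNat, map_intCast, conj_I, conj_ofReal,
    Complex.conj_conj] at h2
  have h14 := sqrt_fourteen_sq
  have hg := gaussSeven_mul_conj
  have hg0 := gaussSeven_ne_zero
  have hg1 : starRingEnd ℂ gaussSeven ≠ 0 := by simpa using hg0
  have h14' : ((Real.sqrt 14 : ℝ) : ℂ) ≠ 0 := by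
    intro h0; rw [h0] at h14; norm_num at h14
  rw [h2]
  generalize ((Real.sqrt 14 : ℝ) : ℂ) = s at *
  generalize starRingEnd ℂ gaussSeven = g' at *
  generalize gaussSeven = g at *
  have hsg : ((1 - 2 * (ε : ℂ)) * (1 - 2 * δ)) ^ 2 = 1 := by
    rcases hε with rfl | rfl <;> rcases hδ with rfl | rfl <;> norm_num
  have e3 : (1 - 2 * (ε : ℂ)) * (1 - 2 * δ) / g * (I / (z * s)) *
      ((1 - 2 * (δ : ℂ)) * (1 - 2 * ε) / g' * (-I / (1 / (98 * z) * s))) = 1 := by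
    have : (1 - 2 * (ε : ℂ)) * (1 - 2 * δ) / g * (I / (z * s)) *
      ((1 - 2 * (δ : ℂ)) * (1 - 2 * ε) / g' * (-I / (1 / (98 * z) * s))) =
      ((1 - 2 * (ε : ℂ)) * (1 - 2 * δ)) ^ 2 * (-98 * I ^ 2) / (g * g' * s ^ 2) := by
      field_simp
    rw [this, hsg, hg, h14, I_sq]; norm_num
  rw [← mul_assoc, e3, one_mul]

end twoSevenths

/-! ### Euler's product, the discriminant and the eta quotient -/

/-- Euler's product `∏ (1 - x ^ n)`. -/
noncomputable def eulerProd (x : ℂ) : ℂ := ∏' n : ℕ, (1 - x ^ (n + 1))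

lemma differentiableOn_eulerProd : DifferentiableOn ℂ eulerProd (Metric.ball 0 1) :=
  ModularForm.differentiableOn_tprod_one_sub_pow

lemma eulerProd_ne_zero {x : ℂ} (hx : ‖x‖ < 1) : eulerProd x ≠ 0 := by
  unfold eulerProd
  simp_rw [sub_eq_add_neg]
  refine tprod_one_add_ne_zero_of_summable (f := fun n => -x ^ (n + 1)) (fun n h => ?_) ?_
  · have h1 : x ^ (n + 1) = 1 := by linear_combination -h
    have h2 : ‖x‖ ^ (n + 1) < 1 := pow_lt_one₀ (norm_nonneg _) hx (by omega)
    rw [← norm_pow, h1, norm_one] at h2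
    exact lt_irrefl _ h2
  · simpa using (summable_nat_add_iff 1).mpr (summable_geometric_of_lt_one (norm_nonneg _) hx)

lemma eulerProd_zero : eulerProd 0 = 1 := by simp [eulerProd]

/-- The discriminant modular form, as a function on `ℂ`. -/
noncomputable def discFun (τ : ℂ) : ℂ :=
  cexp (2 * Real.pi * I * τ) * eulerProd (cexp (2 * Real.pi * I * τ)) ^ 24

lemma norm_cexp_two_pi_lt {τ : ℂ} (hτ : 0 < τ.im) : ‖cexp (2 * Real.pi * I * τ)‖ < 1 :=
  UpperHalfPlane.norm_exp_two_pi_I_lt_one ⟨τ, hτ⟩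

lemma discFun_eq (τ : UpperHalfPlane) : discFun τ = ModularForm.discriminant τ := by
  rw [ModularForm.discriminant_eq_q_prod, discFun, eulerProd,
    ← (ModularForm.multipliable_one_sub_pow (norm_cexp_two_pi_lt τ.2)).tprod_pow]
  simp only [ModularForm.eta_q_eq_pow, Function.Periodic.qParam]
  simp

lemma discFun_ne_zero {τ : ℂ} (hτ : 0 < τ.im) : discFun τ ≠ 0 :=
  mul_ne_zero (Complex.exp_ne_zero _) (pow_ne_zero _ (eulerProd_ne_zero (norm_cexp_two_pi_lt hτ)))

open scoped MatrixGroups in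
lemma discFun_smul (a b c d : ℤ) (h : a * d - b * c = 1) {τ : ℂ} (hτ : 0 < τ.im) :
    discFun ((a * τ + b) / (c * τ + d)) = (c * τ + d) ^ 12 * discFun τ := by
  let γ : Matrix.SpecialLinearGroup (Fin 2) ℤ := ⟨!![a, b; c, d], by
    rw [Matrix.det_fin_two_of]; exact h⟩
  have h1 := SlashInvariantForm.slash_action_eqn'' (Γ := 𝒮ℒ) (k := 12) CuspForm.discriminant
    (γ := Matrix.SpecialLinearGroup.mapGL ℝ γ) ⟨γ, rfl⟩ ⟨τ, hτ⟩
  have h2 : (((Matrix.SpecialLinearGroup.mapGL ℝ γ) • (⟨τ, hτ⟩ : UpperHalfPlane) :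
      UpperHalfPlane) : ℂ) = (a * τ + b) / (c * τ + d) := by
    refine (UpperHalfPlane.coe_specialLinearGroup_apply γ (⟨τ, hτ⟩ : UpperHalfPlane)).trans ?_
    simp [γ]
  have h4 : UpperHalfPlane.denom (Matrix.SpecialLinearGroup.mapGL ℝ γ) τ = c * τ + d := by
    have e0 : (Matrix.SpecialLinearGroup.mapGL ℝ γ : Matrix (Fin 2) (Fin 2) ℝ) 1 0 = c := rfl
    have e1 : (Matrix.SpecialLinearGroup.mapGL ℝ γ : Matrix (Fin 2) (Fin 2) ℝ) 1 1 = d := rfl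
    simp only [UpperHalfPlane.denom, e0, e1]
    norm_cast
  have h3 : ModularForm.discriminant ⟨τ, hτ⟩ = discFun τ := (discFun_eq ⟨τ, hτ⟩).symm
  rw [← h2, discFun_eq]
  refine h1.trans ?_
  rw [← h3]
  simp only [h4]
  norm_cast

/-- Modularity with denominators cleared, so that the image point and the automorphy factor can be
supplied in closed form. -/
lemma discFun_of_mul_eq (a b c d : ℤ) (h : a * d - b * c = 1) {w w' k : ℂ} (hw : 0 < w.im)
    (hk : c * w + d = k) (hk0 : k ≠ 0) (hw' : w' * k = a * w + b) :
    discFun w' = k ^ 12 * discFun w := by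
  rw [← hk, ← discFun_smul a b c d h hw, hk, ← hw', mul_div_cancel_right₀ _ hk0]

lemma im_ofReal_mul_pos {r : ℝ} (hr : 0 < r) {z : ℂ} (hz : 0 < z.im) : 0 < (r * z).im := by
  rw [im_ofReal_mul]; positivity

lemma im_ofNat_mul_pos (n : ℕ) [n.AtLeastTwo] {z : ℂ} (hz : 0 < z.im) :
    0 < ((OfNat.ofNat n : ℂ) * z).im := by
  have := im_ofReal_mul_pos (r := (OfNat.ofNat n : ℝ)) Nat.ofNat_pos hz
  rwa [ofReal_ofNat] at this

/-- The eta quotient on the right-hand side, as a function of `τ` with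
`q = exp (π i τ)`. -/
noncomputable def etaQuot (τ : ℂ) : ℂ :=
  cexp (Real.pi * I * τ) *
    (eulerProd (cexp (2 * Real.pi * I * (14 * τ))) * eulerProd (cexp (2 * Real.pi * I * τ)) /
      (eulerProd (cexp (2 * Real.pi * I * (7 * τ))) *
        eulerProd (cexp (2 * Real.pi * I * (2 * τ))))) ^ 2

lemma eulerProd_cexp_ne_zero {τ : ℂ} (hτ : 0 < τ.im) :
    eulerProd (cexp (2 * Real.pi * I * τ)) ≠ 0 :=
  eulerProd_ne_zero (norm_cexp_two_pi_lt hτ)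

lemma etaQuot_ne_zero {τ : ℂ} (hτ : 0 < τ.im) : etaQuot τ ≠ 0 := by
  have h1 := eulerProd_cexp_ne_zero hτ
  have h2 := eulerProd_cexp_ne_zero (im_ofNat_mul_pos 2 hτ)
  have h7 := eulerProd_cexp_ne_zero (im_ofNat_mul_pos 7 hτ)
  have h14 := eulerProd_cexp_ne_zero (im_ofNat_mul_pos 14 hτ)
  exact mul_ne_zero (Complex.exp_ne_zero _)
    (pow_ne_zero _ (div_ne_zero (mul_ne_zero h14 h1) (mul_ne_zero h7 h2)))

/-- The twelfth power removes the eta multiplier, leaving only the modularity of the discriminant.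
The powers of q agree because 2(14 + 1 - 7 - 2) = 12. -/
lemma etaQuot_pow {τ : ℂ} (hτ : 0 < τ.im) :
    etaQuot τ ^ 12 = discFun (14 * τ) * discFun τ / (discFun (7 * τ) * discFun (2 * τ)) := by
  have h2 := eulerProd_cexp_ne_zero (im_ofNat_mul_pos 2 hτ)
  have h7 := eulerProd_cexp_ne_zero (im_ofNat_mul_pos 7 hτ)
  have e2 := Complex.exp_ne_zero (2 * Real.pi * I * (2 * τ))
  have e7 := Complex.exp_ne_zero (2 * Real.pi * I * (7 * τ))
  have e : cexp (Real.pi * I * τ) ^ 12 * (cexp (2 * Real.pi * I * (7 * τ)) *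
      cexp (2 * Real.pi * I * (2 * τ))) =
      cexp (2 * Real.pi * I * (14 * τ)) * cexp (2 * Real.pi * I * τ) := by
    rw [← Complex.exp_nat_mul, ← Complex.exp_add, ← Complex.exp_add, ← Complex.exp_add]
    congr 1
    push_cast
    ring
  unfold etaQuot discFun
  change eulerProd (cexp (2 * Real.pi * I * (2 * τ))) ≠ 0 at h2
  change eulerProd (cexp (2 * Real.pi * I * (7 * τ))) ≠ 0 at h7
  generalize eulerProd (cexp (2 * Real.pi * I * (2 * τ))) = x2 at *
  generalize eulerProd (cexp (2 * Real.pi * I * (7 * τ))) = x7 at *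
  generalize eulerProd (cexp (2 * Real.pi * I * (14 * τ))) = x14 at *
  generalize eulerProd (cexp (2 * Real.pi * I * τ)) = x1 at *
  generalize cexp (2 * Real.pi * I * (2 * τ)) = y2 at *
  generalize cexp (2 * Real.pi * I * (7 * τ)) = y7 at *
  generalize cexp (2 * Real.pi * I * (14 * τ)) = y14 at *
  generalize cexp (2 * Real.pi * I * τ) = y1 at *
  generalize cexp (Real.pi * I * τ) = y at *
  field_simp
  linear_combination x14 ^ 24 * x1 ^ 24 * e

lemma differentiableOn_eulerProd_cexp (c : ℝ) (hc : 0 < c) :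
    DifferentiableOn ℂ (fun τ => eulerProd (cexp (2 * Real.pi * I * (c * τ)))) {τ | 0 < τ.im} := by
  refine differentiableOn_eulerProd.comp (by fun_prop) fun τ hτ => ?_
  rw [mem_ball_zero_iff]
  exact norm_cexp_two_pi_lt (im_ofReal_mul_pos hc hτ)

lemma differentiableOn_etaQuot : DifferentiableOn ℂ etaQuot {τ | 0 < τ.im} := by
  have d1 := differentiableOn_eulerProd_cexp 1 one_pos
  have d2 := differentiableOn_eulerProd_cexp 2 two_pos
  have d7 := differentiableOn_eulerProd_cexp 7 (by norm_num)
  have d14 := differentiableOn_eulerProd_cexp 14 (by norm_num)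
  push_cast at d1 d2 d7 d14
  simp only [one_mul] at d1
  refine DifferentiableOn.mul (by fun_prop) (((d14.mul d1).div (d7.mul d2) fun τ hτ => ?_).pow 2)
  exact mul_ne_zero (eulerProd_cexp_ne_zero (im_ofNat_mul_pos 7 hτ))
    (eulerProd_cexp_ne_zero (im_ofNat_mul_pos 2 hτ))

lemma differentiableOn_discFun : DifferentiableOn ℂ discFun {τ | 0 < τ.im} := by
  have d1 := differentiableOn_eulerProd_cexp 1 one_pos
  push_cast at d1
  simp only [one_mul] at d1
  exact DifferentiableOn.mul (by fun_prop) (d1.pow 24)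

lemma etaQuot_add_one (τ : ℂ) : etaQuot (τ + 1) = -etaQuot τ := by
  have h (n : ℕ) : cexp (2 * Real.pi * I * (n * (τ + 1))) = cexp (2 * Real.pi * I * (n * τ)) :=
    Complex.exp_eq_exp_iff_exists_int.2 ⟨n, by push_cast; ring⟩
  have h1 := h 1
  have h2 := h 2
  have h7 := h 7
  have h14 := h 14
  push_cast at h1 h2 h7 h14
  rw [one_mul, one_mul] at h1
  unfold etaQuot
  rw [h1, h2, h7, h14, mul_add, Complex.exp_add, mul_one, Complex.exp_pi_mul_I]
  ring

lemma eulerProd_conj {x : ℂ} (hx : ‖x‖ < 1) :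
    eulerProd (starRingEnd ℂ x) = starRingEnd ℂ (eulerProd x) := by
  unfold eulerProd
  rw [(ModularForm.multipliable_one_sub_pow hx).map_tprod (starRingEnd ℂ) continuous_conj]
  simp

lemma etaQuot_conj {τ : ℂ} (hτ : 0 < τ.im) :
    etaQuot (-starRingEnd ℂ τ) = starRingEnd ℂ (etaQuot τ) := by
  have h (c : ℂ) (hc : starRingEnd ℂ c = c) : cexp (c * I * -starRingEnd ℂ τ) =
      starRingEnd ℂ (cexp (c * I * τ)) := by
    rw [← Complex.exp_conj, map_mul, map_mul, hc, conj_I]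
    congr 1
    ring
  have h' (c : ℝ) : cexp (2 * Real.pi * I * (c * -starRingEnd ℂ τ)) =
      starRingEnd ℂ (cexp (2 * Real.pi * I * (c * τ))) := by
    rw [show 2 * Real.pi * I * (c * -starRingEnd ℂ τ) = ((2 * Real.pi * c : ℝ) : ℂ) * I *
      -starRingEnd ℂ τ by push_cast; ring, h _ (conj_ofReal _)]
    congr 2
    push_cast
    ring
  have h1 := h' 1
  have h2 := h' 2
  have h7 := h' 7
  have h14 := h' 14
  push_cast at h1 h2 h7 h14
  rw [one_mul, one_mul] at h1
  unfold etaQuot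
  rw [h1, h2, h7, h14, h _ (conj_ofReal _), eulerProd_conj (norm_cexp_two_pi_lt hτ),
    eulerProd_conj (norm_cexp_two_pi_lt (im_ofNat_mul_pos 2 hτ)),
    eulerProd_conj (norm_cexp_two_pi_lt (im_ofNat_mul_pos 7 hτ)),
    eulerProd_conj (norm_cexp_two_pi_lt (im_ofNat_mul_pos 14 hτ))]
  simp only [map_mul, map_pow, map_div₀]

/-- Such a function has modulus 1 everywhere, so the maximum principle applies at any point. This
reduces the unknown twelfth root of unity in each law for `etaQuot` to one evaluation. -/
lemma eq_const_of_pow_eq_unit {f : ℂ → ℂ} (hf : DifferentiableOn ℂ f {τ | 0 < τ.im})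
    (h : ∀ τ : ℂ, 0 < τ.im → f τ ^ 12 = 1) {c τ : ℂ} (hc : 0 < c.im) (hτ : 0 < τ.im) :
    f τ = f c := by
  have hn (τ : ℂ) (hτ : 0 < τ.im) : ‖f τ‖ = 1 :=
    (pow_eq_one_iff_of_nonneg (norm_nonneg _) (by norm_num : 12 ≠ 0)).1
      (by rw [← norm_pow, h τ hτ, norm_one])
  refine Complex.eqOn_of_isPreconnected_of_isMaxOn_norm (U := {τ : ℂ | 0 < τ.im})
    (convex_halfSpace_im_gt 0).isPreconnected (isOpen_lt continuous_const continuous_im)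
    hf hc (fun z hz => ?_) hτ
  rw [Set.mem_ofPred_eq, Function.comp_apply, Function.comp_apply, hn z hz, hn c hc]

lemma ne_zero_of_im_pos {z : ℂ} (hz : 0 < z.im) : z ≠ 0 := by
  rintro rfl
  simp at hz

section fricke

variable {τ : ℂ} (hτ : 0 < τ.im)
include hτ

lemma discFun_fricke : discFun (-1 / (14 * τ)) = (14 * τ) ^ 12 * discFun (14 * τ) :=
  discFun_of_mul_eq 0 (-1) 1 0 (by norm_num) (im_ofNat_mul_pos 14 hτ) (by push_cast; ring)
    (mul_ne_zero (by norm_num) (ne_zero_of_im_pos hτ))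
    (by have := ne_zero_of_im_pos hτ; push_cast; field_simp; ring)

lemma discFun_fricke_two : discFun (2 * (-1 / (14 * τ))) = (7 * τ) ^ 12 * discFun (7 * τ) :=
  discFun_of_mul_eq 0 (-1) 1 0 (by norm_num) (im_ofNat_mul_pos 7 hτ) (by push_cast; ring)
    (mul_ne_zero (by norm_num) (ne_zero_of_im_pos hτ))
    (by have := ne_zero_of_im_pos hτ; push_cast; field_simp; ring)

lemma discFun_fricke_seven : discFun (7 * (-1 / (14 * τ))) = (2 * τ) ^ 12 * discFun (2 * τ) :=
  discFun_of_mul_eq 0 (-1) 1 0 (by norm_num) (im_ofNat_mul_pos 2 hτ) (by push_cast; ring)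
    (mul_ne_zero (by norm_num) (ne_zero_of_im_pos hτ))
    (by have := ne_zero_of_im_pos hτ; push_cast; field_simp; ring)

lemma discFun_fricke_fourteen : discFun (14 * (-1 / (14 * τ))) = τ ^ 12 * discFun τ :=
  discFun_of_mul_eq 0 (-1) 1 0 (by norm_num) hτ (by push_cast; ring) (ne_zero_of_im_pos hτ)
    (by have := ne_zero_of_im_pos hτ; push_cast; field_simp; ring)

lemma im_fricke_pos : 0 < (-1 / (14 * τ)).im := by
  have := im_neg_inv_pos hτ (M := 14) (by norm_num)
  rw [← neg_div] at this
  exact_mod_cast this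

end fricke

section half

variable {z : ℂ} (hz : 0 < z.im)
include hz

lemma im_half_add_pos : 0 < (1 / 2 + z).im := by simpa using hz

lemma im_half_sub_pos : 0 < (1 / 2 - 1 / (28 * z)).im := by
  have := im_neg_inv_pos hz (M := 28) (by norm_num)
  push_cast at this
  rw [sub_eq_add_neg, add_im]
  simpa using this

lemma discFun_half :
    discFun (1 / 2 - 1 / (28 * z)) = (14 * z) ^ 12 * discFun (7 * (1 / 2 + z)) :=
  discFun_of_mul_eq 1 (-4) 2 (-7) (by norm_num) (im_ofNat_mul_pos 7 (im_half_add_pos hz))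
    (by push_cast; ring) (mul_ne_zero (by norm_num) (ne_zero_of_im_pos hz))
    (by have := ne_zero_of_im_pos hz; push_cast; field_simp; ring)

lemma discFun_half_two :
    discFun (2 * (1 / 2 - 1 / (28 * z))) = (14 * z) ^ 12 * discFun (14 * (1 / 2 + z)) :=
  discFun_of_mul_eq 1 (-8) 1 (-7) (by norm_num) (im_ofNat_mul_pos 14 (im_half_add_pos hz))
    (by push_cast; ring) (mul_ne_zero (by norm_num) (ne_zero_of_im_pos hz))
    (by have := ne_zero_of_im_pos hz; push_cast; field_simp; ring)

lemma discFun_half_seven :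
    discFun (7 * (1 / 2 - 1 / (28 * z))) = (2 * z) ^ 12 * discFun (1 / 2 + z) :=
  discFun_of_mul_eq 7 (-4) 2 (-1) (by norm_num) (im_half_add_pos hz)
    (by push_cast; ring) (mul_ne_zero (by norm_num) (ne_zero_of_im_pos hz))
    (by have := ne_zero_of_im_pos hz; push_cast; field_simp; ring)

lemma discFun_half_fourteen :
    discFun (14 * (1 / 2 - 1 / (28 * z))) = (2 * z) ^ 12 * discFun (2 * (1 / 2 + z)) :=
  discFun_of_mul_eq 7 (-8) 1 (-1) (by norm_num) (im_ofNat_mul_pos 2 (im_half_add_pos hz))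
    (by push_cast; ring) (mul_ne_zero (by norm_num) (ne_zero_of_im_pos hz))
    (by have := ne_zero_of_im_pos hz; push_cast; field_simp; ring)

end half

section twoSevenths

variable {z : ℂ} (hz : 0 < z.im)
include hz

lemma im_two_sevenths_add_pos : 0 < (2 / 7 + z).im := by
  have : ((2 : ℂ) / 7).im = 0 := by
    rw [show (2 : ℂ) / 7 = ((2 / 7 : ℝ) : ℂ) by push_cast; rfl, ofReal_im]
  rwa [add_im, this, zero_add]

lemma im_two_sevenths_sub_pos : 0 < (-(2 / 7) - 1 / (98 * z)).im := by
  have := im_neg_inv_pos hz (M := 98) (by norm_num)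
  push_cast at this
  have h2 : (-((2 : ℂ) / 7)).im = 0 := by
    rw [show -((2 : ℂ) / 7) = ((-(2 / 7) : ℝ) : ℂ) by push_cast; rfl, ofReal_im]
  rwa [sub_eq_add_neg, add_im, h2, zero_add]

lemma discFun_two_sevenths :
    discFun (-(2 / 7) - 1 / (98 * z)) = (14 * z) ^ 12 * discFun (2 * (2 / 7 + z)) :=
  discFun_of_mul_eq (-2) 1 7 (-4) (by norm_num)
    (im_ofNat_mul_pos 2 (im_two_sevenths_add_pos hz))
    (by push_cast; ring) (mul_ne_zero (by norm_num) (ne_zero_of_im_pos hz))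
    (by have := ne_zero_of_im_pos hz; push_cast; field_simp; ring)

lemma discFun_two_sevenths_two :
    discFun (2 * (-(2 / 7) - 1 / (98 * z))) = (7 * z) ^ 12 * discFun (2 / 7 + z) :=
  discFun_of_mul_eq (-4) 1 7 (-2) (by norm_num) (im_two_sevenths_add_pos hz)
    (by push_cast; ring) (mul_ne_zero (by norm_num) (ne_zero_of_im_pos hz))
    (by have := ne_zero_of_im_pos hz; push_cast; field_simp; ring)

lemma discFun_two_sevenths_seven :
    discFun (7 * (-(2 / 7) - 1 / (98 * z))) = (14 * z) ^ 12 * discFun (14 * (2 / 7 + z)) :=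
  discFun_of_mul_eq (-2) 7 1 (-4) (by norm_num)
    (im_ofNat_mul_pos 14 (im_two_sevenths_add_pos hz))
    (by push_cast; ring) (mul_ne_zero (by norm_num) (ne_zero_of_im_pos hz))
    (by have := ne_zero_of_im_pos hz; push_cast; field_simp; ring)

lemma discFun_two_sevenths_fourteen :
    discFun (14 * (-(2 / 7) - 1 / (98 * z))) = (7 * z) ^ 12 * discFun (7 * (2 / 7 + z)) :=
  discFun_of_mul_eq (-4) 7 1 (-2) (by norm_num)
    (im_ofNat_mul_pos 7 (im_two_sevenths_add_pos hz))
    (by push_cast; ring) (mul_ne_zero (by norm_num) (ne_zero_of_im_pos hz))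
    (by have := ne_zero_of_im_pos hz; push_cast; field_simp; ring)

end twoSevenths

/-- The root of unity is read off at the fixed point i/√14, where the ratio is trivially 1. -/
lemma etaQuot_fricke {τ : ℂ} (hτ : 0 < τ.im) : etaQuot (-1 / (14 * τ)) = etaQuot τ := by
  have hc : 0 < ((1 / Real.sqrt 14 : ℝ) * I : ℂ).im := by
    rw [im_ofReal_mul, I_im]; positivity
  have hd : DifferentiableOn ℂ (fun τ => etaQuot (-1 / (14 * τ)) / etaQuot τ)
      {τ | 0 < τ.im} := by
    refine DifferentiableOn.div (differentiableOn_etaQuot.comp ?_ fun τ hτ => im_fricke_pos hτ)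
      differentiableOn_etaQuot fun τ hτ => etaQuot_ne_zero hτ
    exact DifferentiableOn.div (by fun_prop) (by fun_prop) fun τ hτ =>
      mul_ne_zero (by norm_num) (ne_zero_of_im_pos hτ)
  have h := eq_const_of_pow_eq_unit hd (fun τ hτ => by
    have h0 := ne_zero_of_im_pos hτ
    have h1 := discFun_ne_zero hτ
    have h2 : discFun (2 * τ) ≠ 0 := discFun_ne_zero (im_ofNat_mul_pos 2 hτ)
    have h7 : discFun (7 * τ) ≠ 0 := discFun_ne_zero (im_ofNat_mul_pos 7 hτ)
    have h14 : discFun (14 * τ) ≠ 0 := discFun_ne_zero (im_ofNat_mul_pos 14 hτ)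
    rw [div_pow, etaQuot_pow (im_fricke_pos hτ), etaQuot_pow hτ, discFun_fricke hτ,
      discFun_fricke_two hτ, discFun_fricke_seven hτ, discFun_fricke_fourteen hτ]
    generalize discFun τ = d1 at *
    generalize discFun (2 * τ) = d2 at *
    generalize discFun (7 * τ) = d7 at *
    generalize discFun (14 * τ) = d14 at *
    field_simp
    norm_num) hc hτ
  have hfix : (-1 / (14 * ((1 / Real.sqrt 14 : ℝ) * I)) : ℂ) = (1 / Real.sqrt 14 : ℝ) * I := by
    have h14 : (Real.sqrt 14 : ℂ) ≠ 0 := by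
      rw [ofReal_ne_zero]; positivity
    have := sqrt_fourteen_sq
    rw [div_eq_iff (mul_ne_zero (by norm_num) (ne_zero_of_im_pos hc))]
    push_cast
    field_simp
    rw [this, I_sq]
    norm_num
  simp only [hfix] at h
  rwa [div_self (etaQuot_ne_zero hc), div_eq_one_iff_eq (etaQuot_ne_zero hτ)] at h

lemma etaQuot_half_pow {z : ℂ} (hz : 0 < z.im) :
    (etaQuot (1 / 2 + z) * etaQuot (1 / 2 - 1 / (28 * z))) ^ 12 = 1 := by
  have h0 := ne_zero_of_im_pos hz
  have hτ := im_half_add_pos hz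
  have h1 := discFun_ne_zero hτ
  have h2 : discFun (2 * (1 / 2 + z)) ≠ 0 := discFun_ne_zero (im_ofNat_mul_pos 2 hτ)
  have h7 : discFun (7 * (1 / 2 + z)) ≠ 0 := discFun_ne_zero (im_ofNat_mul_pos 7 hτ)
  have h14 : discFun (14 * (1 / 2 + z)) ≠ 0 := discFun_ne_zero (im_ofNat_mul_pos 14 hτ)
  rw [mul_pow, etaQuot_pow (im_half_sub_pos hz), etaQuot_pow hτ, discFun_half hz,
    discFun_half_two hz, discFun_half_seven hz, discFun_half_fourteen hz]
  generalize discFun (1 / 2 + z) = d1 at *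
  generalize discFun (2 * (1 / 2 + z)) = d2 at *
  generalize discFun (7 * (1 / 2 + z)) = d7 at *
  generalize discFun (14 * (1 / 2 + z)) = d14 at *
  field_simp

/-- At the fixed point z = i/√28 the product is a square x². On the line Re τ = 1/2, reflection
followed by translation fixes τ, so x = -x̄ and x² = -|x|². The twelfth power then forces |x| = 1.
-/
lemma etaQuot_half {z : ℂ} (hz : 0 < z.im) :
    etaQuot (1 / 2 + z) * etaQuot (1 / 2 - 1 / (28 * z)) = -1 := by
  have hc : 0 < ((1 / Real.sqrt 28 : ℝ) * I : ℂ).im := by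
    rw [im_ofReal_mul, I_im]; positivity
  have hd : DifferentiableOn ℂ (fun z => etaQuot (1 / 2 + z) * etaQuot (1 / 2 - 1 / (28 * z)))
      {τ | 0 < τ.im} := by
    refine DifferentiableOn.mul
      (differentiableOn_etaQuot.comp (by fun_prop) fun τ hτ => im_half_add_pos hτ)
      (differentiableOn_etaQuot.comp ?_ fun τ hτ => im_half_sub_pos hτ)
    exact DifferentiableOn.sub (by fun_prop) (DifferentiableOn.div (by fun_prop) (by fun_prop)
      fun τ hτ => mul_ne_zero (by norm_num) (ne_zero_of_im_pos hτ))
  have h := eq_const_of_pow_eq_unit hd (fun z hz => etaQuot_half_pow hz) hc hz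
  have hfix : (1 / 2 - 1 / (28 * ((1 / Real.sqrt 28 : ℝ) * I)) : ℂ) =
      1 / 2 + (1 / Real.sqrt 28 : ℝ) * I := by
    have h28 : (Real.sqrt 28 : ℂ) ≠ 0 := by
      rw [ofReal_ne_zero]; positivity
    have : (Real.sqrt 28 : ℂ) ^ 2 = 28 := by
      rw [← ofReal_pow, Real.sq_sqrt (by norm_num)]; norm_num
    rw [sub_eq_add_neg]
    congr 1
    rw [← neg_div, div_eq_iff (mul_ne_zero (by norm_num) (ne_zero_of_im_pos hc))]
    push_cast
    field_simp
    rw [this, I_sq]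
    norm_num
  simp only [hfix] at h
  rw [h]
  have hconj := etaQuot_conj (im_half_add_pos hc)
  have hneg := etaQuot_add_one (-starRingEnd ℂ (1 / 2 + (1 / Real.sqrt 28 : ℝ) * I))
  rw [hconj, show -starRingEnd ℂ (1 / 2 + (1 / Real.sqrt 28 : ℝ) * I) + 1 =
    1 / 2 + (1 / Real.sqrt 28 : ℝ) * I by
      simp only [map_add, map_mul, conj_ofReal, conj_I, map_div₀, map_one, map_ofNat]; ring]
    at hneg
  set x := etaQuot (1 / 2 + (1 / Real.sqrt 28 : ℝ) * I)
  have hx : x * x = -((normSq x : ℝ) : ℂ) := by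
    rw [← mul_conj]
    linear_combination x * hneg
  have hp := etaQuot_half_pow hc
  rw [hfix, hx, neg_pow] at hp
  have hp' : normSq x ^ 12 = 1 := by
    have : ((normSq x ^ 12 : ℝ) : ℂ) = 1 := by push_cast; linear_combination hp
    exact_mod_cast this
  rw [hx, (pow_eq_one_iff_of_nonneg (normSq_nonneg _) (by norm_num)).1 hp', ofReal_one]

lemma etaQuot_two_sevenths_pow {z : ℂ} (hz : 0 < z.im) :
    (etaQuot (2 / 7 + z) * etaQuot (-(2 / 7) - 1 / (98 * z))) ^ 12 = 1 := by
  have h0 := ne_zero_of_im_pos hz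
  have hτ := im_two_sevenths_add_pos hz
  have h1 := discFun_ne_zero hτ
  have h2 : discFun (2 * (2 / 7 + z)) ≠ 0 := discFun_ne_zero (im_ofNat_mul_pos 2 hτ)
  have h7 : discFun (7 * (2 / 7 + z)) ≠ 0 := discFun_ne_zero (im_ofNat_mul_pos 7 hτ)
  have h14 : discFun (14 * (2 / 7 + z)) ≠ 0 := discFun_ne_zero (im_ofNat_mul_pos 14 hτ)
  rw [mul_pow, etaQuot_pow (im_two_sevenths_sub_pos hz), etaQuot_pow hτ, discFun_two_sevenths hz,
    discFun_two_sevenths_two hz, discFun_two_sevenths_seven hz, discFun_two_sevenths_fourteen hz]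
  generalize discFun (2 / 7 + z) = d1 at *
  generalize discFun (2 * (2 / 7 + z)) = d2 at *
  generalize discFun (7 * (2 / 7 + z)) = d7 at *
  generalize discFun (14 * (2 / 7 + z)) = d14 at *
  field_simp

/-- At z = i/√98 the two arguments are mirror images under τ ↦ -τ̄, so the product is |x|² > 0, and
the only positive twelfth root of 1 is 1. -/
lemma etaQuot_two_sevenths {z : ℂ} (hz : 0 < z.im) :
    etaQuot (2 / 7 + z) * etaQuot (-(2 / 7) - 1 / (98 * z)) = 1 := by
  have hc : 0 < ((1 / Real.sqrt 98 : ℝ) * I : ℂ).im := by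
    rw [im_ofReal_mul, I_im]; positivity
  have hd : DifferentiableOn ℂ
      (fun z => etaQuot (2 / 7 + z) * etaQuot (-(2 / 7) - 1 / (98 * z))) {τ | 0 < τ.im} := by
    refine DifferentiableOn.mul
      (differentiableOn_etaQuot.comp (by fun_prop) fun τ hτ => im_two_sevenths_add_pos hτ)
      (differentiableOn_etaQuot.comp ?_ fun τ hτ => im_two_sevenths_sub_pos hτ)
    exact DifferentiableOn.sub (by fun_prop) (DifferentiableOn.div (by fun_prop) (by fun_prop)
      fun τ hτ => mul_ne_zero (by norm_num) (ne_zero_of_im_pos hτ))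
  have h := eq_const_of_pow_eq_unit hd (fun z hz => etaQuot_two_sevenths_pow hz) hc hz
  have hfix : (-(2 / 7) - 1 / (98 * ((1 / Real.sqrt 98 : ℝ) * I)) : ℂ) =
      -starRingEnd ℂ (2 / 7 + (1 / Real.sqrt 98 : ℝ) * I) := by
    have h98 : (Real.sqrt 98 : ℂ) ≠ 0 := by
      rw [ofReal_ne_zero]; positivity
    have : (Real.sqrt 98 : ℂ) ^ 2 = 98 := by
      rw [← ofReal_pow, Real.sq_sqrt (by norm_num)]; norm_num
    simp only [map_add, map_mul, conj_ofReal, conj_I, map_div₀, map_ofNat]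
    rw [neg_add, mul_neg, neg_neg, sub_eq_add_neg]
    congr 1
    rw [← neg_div, div_eq_iff (mul_ne_zero (by norm_num) (ne_zero_of_im_pos hc))]
    push_cast
    field_simp
    rw [this, I_sq]
    norm_num
  rw [hfix, etaQuot_conj (im_two_sevenths_add_pos hc), mul_conj] at h
  rw [h]
  have hp := etaQuot_two_sevenths_pow hc
  rw [hfix, etaQuot_conj (im_two_sevenths_add_pos hc), mul_conj] at hp
  rw [(pow_eq_one_iff_of_nonneg (normSq_nonneg _) (by norm_num)).1 (by exact_mod_cast hp :
    normSq (etaQuot (2 / 7 + (1 / Real.sqrt 98 : ℝ) * I)) ^ 12 = 1), ofReal_one]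

/-- The product of the discriminant over the divisors of `14`. -/
noncomputable def discProd (τ : ℂ) : ℂ :=
  discFun τ * discFun (2 * τ) * (discFun (7 * τ) * discFun (14 * τ))

lemma discProd_ne_zero {τ : ℂ} (hτ : 0 < τ.im) : discProd τ ≠ 0 :=
  mul_ne_zero (mul_ne_zero (discFun_ne_zero hτ) (discFun_ne_zero (im_ofNat_mul_pos 2 hτ)))
    (mul_ne_zero (discFun_ne_zero (im_ofNat_mul_pos 7 hτ))
      (discFun_ne_zero (im_ofNat_mul_pos 14 hτ)))

lemma discProd_add_one (τ : ℂ) : discProd (τ + 1) = discProd τ := by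
  have h (n : ℕ) : cexp (2 * Real.pi * I * (n * (τ + 1))) = cexp (2 * Real.pi * I * (n * τ)) :=
    Complex.exp_eq_exp_iff_exists_int.2 ⟨n, by push_cast; ring⟩
  have h1 := h 1
  have h2 := h 2
  have h7 := h 7
  have h14 := h 14
  push_cast at h1 h2 h7 h14
  rw [one_mul, one_mul] at h1
  unfold discProd discFun
  rw [h1, h2, h7, h14]

lemma discProd_fricke {τ : ℂ} (hτ : 0 < τ.im) :
    discProd (-1 / (14 * τ)) = (14 * τ ^ 2) ^ 24 * discProd τ := by
  unfold discProd
  rw [discFun_fricke hτ, discFun_fricke_two hτ, discFun_fricke_seven hτ,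
    discFun_fricke_fourteen hτ]
  ring

lemma discProd_half {z : ℂ} (hz : 0 < z.im) :
    discProd (1 / 2 - 1 / (28 * z)) = (28 * z ^ 2) ^ 24 * discProd (1 / 2 + z) := by
  rw [discProd, discFun_half hz, discFun_half_two hz, discFun_half_seven hz,
    discFun_half_fourteen hz, discProd]
  generalize discFun (1 / 2 + z) = d1
  generalize discFun (2 * (1 / 2 + z)) = d2
  generalize discFun (7 * (1 / 2 + z)) = d7
  generalize discFun (14 * (1 / 2 + z)) = d14
  ring

lemma discProd_two_sevenths {z : ℂ} (hz : 0 < z.im) :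
    discProd (-(2 / 7) - 1 / (98 * z)) = (98 * z ^ 2) ^ 24 * discProd (2 / 7 + z) := by
  rw [discProd, discFun_two_sevenths hz, discFun_two_sevenths_two hz,
    discFun_two_sevenths_seven hz, discFun_two_sevenths_fourteen hz, discProd]
  generalize discFun (2 / 7 + z) = d1
  generalize discFun (2 * (2 / 7 + z)) = d2
  generalize discFun (7 * (2 / 7 + z)) = d7
  generalize discFun (14 * (2 / 7 + z)) = d14
  ring

lemma differentiableOn_discProd : DifferentiableOn ℂ discProd {τ | 0 < τ.im} := by
  have h (c : ℝ) (hc : 0 < c) : DifferentiableOn ℂ (fun τ => discFun (c * τ)) {τ | 0 < τ.im} :=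
    differentiableOn_discFun.comp (by fun_prop) fun τ hτ => im_ofReal_mul_pos hc hτ
  have h2 := h 2 (by norm_num)
  have h7 := h 7 (by norm_num)
  have h14 := h 14 (by norm_num)
  push_cast at h2 h7 h14
  exact (differentiableOn_discFun.mul h2).mul (h7.mul h14)

/-! ### The four defects and their permutation -/

/-- The difference of the two sides of the identity, as a function of `τ`. -/
noncomputable def defect₀₀ (τ : ℂ) : ℂ :=
  thetaA 0 0 τ - thetaC 0 0 τ - etaQuot τ * (thetaB 0 0 τ + thetaC 0 0 τ)

/-- The companion of `defect₀₀` with characteristic `(1, 0)`. -/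
noncomputable def defect₁₀ (τ : ℂ) : ℂ :=
  thetaA 1 0 τ - thetaC 1 0 τ + etaQuot τ * (thetaB 1 0 τ + thetaC 1 0 τ)

/-- The companion of `defect₀₀` with characteristic `(0, 1)`. -/
noncomputable def defect₀₁ (τ : ℂ) : ℂ :=
  thetaA 0 1 τ - thetaC 0 1 τ + etaQuot τ * (thetaB 0 1 τ + thetaC 0 1 τ)

/-- The companion of `defect₀₀` with characteristic `(1, 1)`. -/
noncomputable def defect₁₁ (τ : ℂ) : ℂ :=
  thetaA 1 1 τ + thetaC 1 1 τ + etaQuot τ * (thetaB 1 1 τ + thetaC 1 1 τ)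

lemma defect₀₀_add_one (τ : ℂ) : defect₀₀ (τ + 1) = defect₁₀ τ := by
  simp only [defect₀₀, defect₁₀, etaQuot_add_one, thetaA_add_one_zero, thetaB_add_one_zero,
    thetaC_add_one_zero, sub_zero]
  ring

lemma defect₁₀_add_one (τ : ℂ) : defect₁₀ (τ + 1) = defect₀₀ τ := by
  simp only [defect₀₀, defect₁₀, etaQuot_add_one, thetaA_add_one_zero, thetaB_add_one_zero,
    thetaC_add_one_zero, sub_self]
  ring

lemma defect₀₁_add_one (τ : ℂ) : defect₀₁ (τ + 1) = -I * defect₁₁ τ := by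
  simp only [defect₀₁, defect₁₁, etaQuot_add_one, thetaA_add_one_one, thetaB_add_one_one,
    thetaC_add_one_one, sub_zero]
  ring

lemma defect₁₁_add_one (τ : ℂ) : defect₁₁ (τ + 1) = -I * defect₀₁ τ := by
  simp only [defect₀₁, defect₁₁, etaQuot_add_one, thetaA_add_one_one, thetaB_add_one_one,
    thetaC_add_one_one, sub_self]
  ring

section fricke

variable {τ : ℂ} (hτ : 0 < τ.im)
include hτ

lemma defect₀₀_fricke : defect₀₀ τ = I / (τ * Real.sqrt 14) * defect₀₀ (-1 / (14 * τ)) := by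
  rw [defect₀₀, defect₀₀, etaQuot_fricke hτ, thetaA_inv _ _ hτ, thetaB_inv _ _ hτ,
    thetaC_inv _ _ hτ]
  ring

lemma defect₁₀_fricke : defect₁₀ τ = I / (τ * Real.sqrt 14) * defect₀₁ (-1 / (14 * τ)) := by
  rw [defect₁₀, defect₀₁, etaQuot_fricke hτ, thetaA_inv _ _ hτ, thetaB_inv _ _ hτ,
    thetaC_inv _ _ hτ]
  ring

lemma defect₀₁_fricke : defect₀₁ τ = I / (τ * Real.sqrt 14) * defect₁₀ (-1 / (14 * τ)) := by
  rw [defect₁₀, defect₀₁, etaQuot_fricke hτ, thetaA_inv _ _ hτ, thetaB_inv _ _ hτ,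
    thetaC_inv _ _ hτ]
  ring

lemma defect₁₁_fricke : defect₁₁ τ = I / (τ * Real.sqrt 14) * defect₁₁ (-1 / (14 * τ)) := by
  rw [defect₁₁, defect₁₁, etaQuot_fricke hτ, thetaA_inv _ _ hτ, thetaB_inv _ _ hτ,
    thetaC_inv _ _ hτ]
  ring

end fricke

section half

variable {z : ℂ} (hz : 0 < z.im)
include hz

/-- The thetas A and B trade places while the eta quotient h goes to -1/h. Pulling out h(1/2 + z)
therefore exchanges the parts A ∓ C and h(B + C) of a defect. -/
lemma defect₀₀_half : defect₀₀ (1 / 2 + z) = -(halfConst 0 * (I / (z * Real.sqrt 14)) *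
    etaQuot (1 / 2 + z)) * defect₀₁ (1 / 2 - 1 / (28 * z)) := by
  rw [defect₀₀, defect₀₁, thetaA_half hz (.inl rfl) (.inl rfl), thetaB_half hz (.inl rfl)
    (.inl rfl), thetaC_half hz (.inl rfl) (.inl rfl), sub_zero]
  push_cast
  linear_combination (thetaB 0 1 (1 / 2 - 1 / (28 * z)) + thetaC 0 1 (1 / 2 - 1 / (28 * z))) *
    (halfConst 0 * (I / (z * Real.sqrt 14))) * etaQuot_half hz

lemma defect₀₁_half : defect₀₁ (1 / 2 + z) = halfConst 0 * (I / (z * Real.sqrt 14)) *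
    etaQuot (1 / 2 + z) * defect₀₀ (1 / 2 - 1 / (28 * z)) := by
  rw [defect₀₀, defect₀₁, thetaA_half hz (.inl rfl) (.inr rfl), thetaB_half hz (.inl rfl)
    (.inr rfl), thetaC_half hz (.inl rfl) (.inr rfl), sub_self]
  push_cast
  linear_combination (thetaB 0 0 (1 / 2 - 1 / (28 * z)) + thetaC 0 0 (1 / 2 - 1 / (28 * z))) *
    (halfConst 0 * (I / (z * Real.sqrt 14))) * etaQuot_half hz

lemma defect₁₀_half : defect₁₀ (1 / 2 + z) = -(halfConst 1 * (I / (z * Real.sqrt 14)) *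
    etaQuot (1 / 2 + z)) * defect₁₁ (1 / 2 - 1 / (28 * z)) := by
  rw [defect₁₀, defect₁₁, thetaA_half hz (.inr rfl) (.inl rfl), thetaB_half hz (.inr rfl)
    (.inl rfl), thetaC_half hz (.inr rfl) (.inl rfl), sub_zero]
  push_cast
  linear_combination (thetaB 1 1 (1 / 2 - 1 / (28 * z)) + thetaC 1 1 (1 / 2 - 1 / (28 * z))) *
    (halfConst 1 * (I / (z * Real.sqrt 14))) * etaQuot_half hz

lemma defect₁₁_half : defect₁₁ (1 / 2 + z) = -(halfConst 1 * (I / (z * Real.sqrt 14)) *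
    etaQuot (1 / 2 + z)) * defect₁₀ (1 / 2 - 1 / (28 * z)) := by
  rw [defect₁₀, defect₁₁, thetaA_half hz (.inr rfl) (.inr rfl), thetaB_half hz (.inr rfl)
    (.inr rfl), thetaC_half hz (.inr rfl) (.inr rfl), sub_self]
  push_cast
  linear_combination (thetaB 1 0 (1 / 2 - 1 / (28 * z)) + thetaC 1 0 (1 / 2 - 1 / (28 * z))) *
    (halfConst 1 * (I / (z * Real.sqrt 14))) * etaQuot_half hz

end half

section twoSevenths

variable {z : ℂ} (hz : 0 < z.im)
include hz

lemma defect₀₀_two_sevenths : defect₀₀ (2 / 7 + z) = -(1 / gaussSeven *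
    (I / (z * Real.sqrt 14)) * etaQuot (2 / 7 + z)) * defect₀₀ (-(2 / 7) - 1 / (98 * z)) := by
  rw [defect₀₀, defect₀₀, thetaA_two_sevenths hz (.inl rfl) (.inl rfl),
    thetaB_two_sevenths hz (.inl rfl) (.inl rfl), thetaC_two_sevenths hz (.inl rfl) (.inl rfl)]
  push_cast
  linear_combination -(thetaB 0 0 (-(2 / 7) - 1 / (98 * z)) +
    thetaC 0 0 (-(2 / 7) - 1 / (98 * z))) * (1 / gaussSeven * (I / (z * Real.sqrt 14))) *
    etaQuot_two_sevenths hz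

lemma defect₁₀_two_sevenths : defect₁₀ (2 / 7 + z) = -(1 / gaussSeven *
    (I / (z * Real.sqrt 14)) * etaQuot (2 / 7 + z)) * defect₀₁ (-(2 / 7) - 1 / (98 * z)) := by
  rw [defect₁₀, defect₀₁, thetaA_two_sevenths hz (.inr rfl) (.inl rfl),
    thetaB_two_sevenths hz (.inr rfl) (.inl rfl), thetaC_two_sevenths hz (.inr rfl) (.inl rfl)]
  push_cast
  linear_combination (thetaB 0 1 (-(2 / 7) - 1 / (98 * z)) +
    thetaC 0 1 (-(2 / 7) - 1 / (98 * z))) * (1 / gaussSeven * (I / (z * Real.sqrt 14))) *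
    etaQuot_two_sevenths hz

lemma defect₀₁_two_sevenths : defect₀₁ (2 / 7 + z) = -(1 / gaussSeven *
    (I / (z * Real.sqrt 14)) * etaQuot (2 / 7 + z)) * defect₁₀ (-(2 / 7) - 1 / (98 * z)) := by
  rw [defect₁₀, defect₀₁, thetaA_two_sevenths hz (.inl rfl) (.inr rfl),
    thetaB_two_sevenths hz (.inl rfl) (.inr rfl), thetaC_two_sevenths hz (.inl rfl) (.inr rfl)]
  push_cast
  linear_combination (thetaB 1 0 (-(2 / 7) - 1 / (98 * z)) +
    thetaC 1 0 (-(2 / 7) - 1 / (98 * z))) * (1 / gaussSeven * (I / (z * Real.sqrt 14))) *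
    etaQuot_two_sevenths hz

lemma defect₁₁_two_sevenths : defect₁₁ (2 / 7 + z) = 1 / gaussSeven *
    (I / (z * Real.sqrt 14)) * etaQuot (2 / 7 + z) * defect₁₁ (-(2 / 7) - 1 / (98 * z)) := by
  rw [defect₁₁, defect₁₁, thetaA_two_sevenths hz (.inr rfl) (.inr rfl),
    thetaB_two_sevenths hz (.inr rfl) (.inr rfl), thetaC_two_sevenths hz (.inr rfl) (.inr rfl)]
  push_cast
  linear_combination -(thetaB 1 1 (-(2 / 7) - 1 / (98 * z)) +
    thetaC 1 1 (-(2 / 7) - 1 / (98 * z))) * (1 / gaussSeven * (I / (z * Real.sqrt 14))) *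
    etaQuot_two_sevenths hz

end twoSevenths

/-- The product of the four defects. -/
noncomputable def defectProd (τ : ℂ) : ℂ :=
  defect₀₀ τ * defect₁₀ τ * defect₀₁ τ * defect₁₁ τ

/-- Four weight-one factors, put in the shape that cancels against the factors of `discProd` after a
twelfth power. Working with norms discards the signs and roots of unity. -/
lemma norm_I_div_pow (z : ℂ) : ‖I / (z * Real.sqrt 14)‖ ^ 4 = ‖(14 * z ^ 2) ^ 2‖⁻¹ := by
  have : (Real.sqrt 14 : ℂ) ^ 4 = 14 ^ 2 := by
    rw [show 4 = 2 * 2 from rfl, pow_mul, sqrt_fourteen_sq]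
  rw [← norm_pow, ← norm_inv, div_pow, mul_pow, this, I_pow_four, one_div]
  ring_nf

lemma defectProd_add_one (τ : ℂ) : ‖defectProd (τ + 1)‖ = ‖defectProd τ‖ := by
  simp only [defectProd, defect₀₀_add_one, defect₁₀_add_one, defect₀₁_add_one, defect₁₁_add_one,
    norm_mul, norm_neg, norm_I]
  ring

lemma norm_defectProd_fricke {τ : ℂ} (hτ : 0 < τ.im) :
    ‖defectProd τ‖ = ‖(14 * τ ^ 2) ^ 2‖⁻¹ * ‖defectProd (-1 / (14 * τ))‖ := by
  rw [defectProd, defect₀₀_fricke hτ, defect₁₀_fricke hτ, defect₀₁_fricke hτ,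
    defect₁₁_fricke hτ, defectProd, ← norm_I_div_pow]
  simp only [norm_mul]
  ring

lemma norm_defectProd_half {z : ℂ} (hz : 0 < z.im) :
    ‖defectProd (1 / 2 + z)‖ = ‖(28 * z ^ 2) ^ 2‖⁻¹ * ‖etaQuot (1 / 2 + z)‖ ^ 4 *
      ‖defectProd (1 / 2 - 1 / (28 * z))‖ := by
  have h0 : ‖halfConst 0‖ ^ 2 = 1 / 2 := by rw [← norm_pow, halfConst_zero_sq]; norm_num
  have h1 : ‖halfConst 1‖ ^ 2 = 1 / 2 := by rw [← norm_pow, halfConst_one_sq]; norm_num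
  have : ‖(28 * z ^ 2) ^ 2‖⁻¹ = ‖halfConst 0‖ ^ 2 * ‖halfConst 1‖ ^ 2 *
      ‖I / (z * Real.sqrt 14)‖ ^ 4 := by
    rw [h0, h1, norm_I_div_pow]
    simp only [norm_pow, norm_mul, norm_ofNat]
    rw [show (28 * ‖z‖ ^ 2) ^ 2 = 2 * 2 * (14 * ‖z‖ ^ 2) ^ 2 by ring, mul_inv]
    norm_num
  rw [defectProd, defect₀₀_half hz, defect₁₀_half hz, defect₀₁_half hz, defect₁₁_half hz,
    defectProd, this]
  simp only [norm_mul, norm_neg]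
  ring

lemma norm_defectProd_two_sevenths {z : ℂ} (hz : 0 < z.im) :
    ‖defectProd (2 / 7 + z)‖ = ‖(98 * z ^ 2) ^ 2‖⁻¹ * ‖etaQuot (2 / 7 + z)‖ ^ 4 *
      ‖defectProd (-(2 / 7) - 1 / (98 * z))‖ := by
  have h0 : ‖gaussSeven‖ ^ 2 = 7 := by
    have h := gaussSeven_mul_conj
    rw [mul_conj, normSq_eq_norm_sq] at h
    exact_mod_cast h
  have : ‖(98 * z ^ 2) ^ 2‖⁻¹ = ((‖gaussSeven‖ ^ 2) ^ 2)⁻¹ * ‖I / (z * Real.sqrt 14)‖ ^ 4 := by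
    rw [h0, norm_I_div_pow]
    simp only [norm_pow, norm_mul, norm_ofNat]
    rw [← mul_inv]
    ring
  rw [defectProd, defect₀₀_two_sevenths hz, defect₁₀_two_sevenths hz, defect₀₁_two_sevenths hz,
    defect₁₁_two_sevenths hz, defectProd, this]
  simp only [norm_mul, norm_neg, norm_div, norm_one]
  ring

/-! ### The invariant quotient -/

/-- A function on the upper half-plane whose absolute value is invariant under the translation
and the Atkin-Lehner involutions of level `14`. -/
noncomputable def invQuot (τ : ℂ) : ℂ := (defectProd τ / etaQuot τ ^ 2) ^ 12 / discProd τ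

lemma norm_invQuot_add_one (τ : ℂ) : ‖invQuot (τ + 1)‖ = ‖invQuot τ‖ := by
  simp only [invQuot, norm_div, norm_pow, defectProd_add_one, etaQuot_add_one, norm_neg,
    discProd_add_one]

lemma norm_invQuot_fricke {τ : ℂ} (hτ : 0 < τ.im) : ‖invQuot (-1 / (14 * τ))‖ = ‖invQuot τ‖ := by
  simp only [invQuot, norm_div, norm_pow, etaQuot_fricke hτ, norm_defectProd_fricke hτ,
    discProd_fricke hτ, norm_mul]
  generalize ‖etaQuot τ‖ = r
  generalize ‖discProd τ‖ = s
  generalize ‖defectProd (-1 / (14 * τ))‖ = t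
  have : ‖τ‖ ≠ 0 := norm_ne_zero_iff.2 (ne_zero_of_im_pos hτ)
  have : ‖(14 : ℂ)‖ ≠ 0 := by norm_num
  field_simp

/-- The defect product picks up |h|⁴ while |h| is inverted, so dividing by h² restores the symmetry;
the weight 48 of the twelfth power cancels against `discProd`. -/
lemma norm_invQuot_half {z : ℂ} (hz : 0 < z.im) :
    ‖invQuot (1 / 2 - 1 / (28 * z))‖ = ‖invQuot (1 / 2 + z)‖ := by
  have h := congrArg norm (etaQuot_half hz)
  rw [norm_mul, norm_neg, norm_one] at h
  have h' : ‖etaQuot (1 / 2 - 1 / (28 * z))‖ = ‖etaQuot (1 / 2 + z)‖⁻¹ :=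
    eq_inv_of_mul_eq_one_right h
  simp only [invQuot, norm_div, norm_pow, h', norm_defectProd_half hz, discProd_half hz, norm_mul]
  have hr : ‖etaQuot (1 / 2 + z)‖ ≠ 0 := left_ne_zero_of_mul_eq_one h
  generalize ‖etaQuot (1 / 2 + z)‖ = r at *
  generalize ‖discProd (1 / 2 + z)‖ = s
  generalize ‖defectProd (1 / 2 - 1 / (28 * z))‖ = t
  have : ‖z‖ ≠ 0 := norm_ne_zero_iff.2 (ne_zero_of_im_pos hz)
  have : ‖(28 : ℂ)‖ ≠ 0 := by norm_num
  field_simp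

lemma norm_invQuot_two_sevenths {z : ℂ} (hz : 0 < z.im) :
    ‖invQuot (-(2 / 7) - 1 / (98 * z))‖ = ‖invQuot (2 / 7 + z)‖ := by
  have h := congrArg norm (etaQuot_two_sevenths hz)
  rw [norm_mul, norm_one] at h
  have h' : ‖etaQuot (-(2 / 7) - 1 / (98 * z))‖ = ‖etaQuot (2 / 7 + z)‖⁻¹ :=
    eq_inv_of_mul_eq_one_right h
  simp only [invQuot, norm_div, norm_pow, h', norm_defectProd_two_sevenths hz,
    discProd_two_sevenths hz, norm_mul]
  have hr : ‖etaQuot (2 / 7 + z)‖ ≠ 0 := left_ne_zero_of_mul_eq_one h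
  generalize ‖etaQuot (2 / 7 + z)‖ = r at *
  generalize ‖discProd (2 / 7 + z)‖ = s
  generalize ‖defectProd (-(2 / 7) - 1 / (98 * z))‖ = t
  have : ‖z‖ ≠ 0 := norm_ne_zero_iff.2 (ne_zero_of_im_pos hz)
  have : ‖(98 : ℂ)‖ ≠ 0 := by norm_num
  field_simp

lemma differentiableOn_thetaA (ε δ : ℤ) : DifferentiableOn ℂ (thetaA ε δ) {τ | 0 < τ.im} :=
  differentiableOn_binTheta (by norm_num) (by norm_num) _ _ _ _

lemma differentiableOn_thetaB (ε δ : ℤ) : DifferentiableOn ℂ (thetaB ε δ) {τ | 0 < τ.im} :=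
  differentiableOn_binTheta (by norm_num) (by norm_num) _ _ _ _

lemma differentiableOn_thetaC (ε δ : ℤ) : DifferentiableOn ℂ (thetaC ε δ) {τ | 0 < τ.im} :=
  differentiableOn_binTheta (by norm_num) (by norm_num) _ _ _ _

lemma differentiableOn_defect₀₀ : DifferentiableOn ℂ defect₀₀ {τ | 0 < τ.im} :=
  ((differentiableOn_thetaA 0 0).sub (differentiableOn_thetaC 0 0)).sub
    (differentiableOn_etaQuot.mul ((differentiableOn_thetaB 0 0).add (differentiableOn_thetaC 0 0)))

lemma differentiableOn_defect₁₀ : DifferentiableOn ℂ defect₁₀ {τ | 0 < τ.im} :=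
  ((differentiableOn_thetaA 1 0).sub (differentiableOn_thetaC 1 0)).add
    (differentiableOn_etaQuot.mul ((differentiableOn_thetaB 1 0).add (differentiableOn_thetaC 1 0)))

lemma differentiableOn_defect₀₁ : DifferentiableOn ℂ defect₀₁ {τ | 0 < τ.im} :=
  ((differentiableOn_thetaA 0 1).sub (differentiableOn_thetaC 0 1)).add
    (differentiableOn_etaQuot.mul ((differentiableOn_thetaB 0 1).add (differentiableOn_thetaC 0 1)))

lemma differentiableOn_defect₁₁ : DifferentiableOn ℂ defect₁₁ {τ | 0 < τ.im} :=
  ((differentiableOn_thetaA 1 1).add (differentiableOn_thetaC 1 1)).add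
    (differentiableOn_etaQuot.mul ((differentiableOn_thetaB 1 1).add (differentiableOn_thetaC 1 1)))

lemma differentiableOn_invQuot : DifferentiableOn ℂ invQuot {τ | 0 < τ.im} :=
  ((((((differentiableOn_defect₀₀.mul differentiableOn_defect₁₀).mul
    differentiableOn_defect₀₁).mul differentiableOn_defect₁₁).div
    (differentiableOn_etaQuot.pow 2) fun _ hτ => pow_ne_zero 2 (etaQuot_ne_zero hτ)).pow 12).div
    differentiableOn_discProd fun _ hτ => discProd_ne_zero hτ)

/-! ### Reduction to height at least 1/20 -/

lemma norm_invQuot_add_nat (τ : ℂ) (n : ℕ) : ‖invQuot (τ + n)‖ = ‖invQuot τ‖ := by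
  induction n with
  | zero => simp
  | succ n ih => rw [Nat.cast_succ, ← add_assoc, norm_invQuot_add_one, ih]

lemma norm_invQuot_add_int (τ : ℂ) (n : ℤ) : ‖invQuot (τ + n)‖ = ‖invQuot τ‖ := by
  obtain ⟨m, rfl | rfl⟩ := n.eq_nat_or_neg
  · exact_mod_cast norm_invQuot_add_nat τ m
  · rw [← norm_invQuot_add_nat _ m]
    push_cast
    rw [neg_add_cancel_right]

lemma exists_translate (τ : ℂ) : ∃ τ' : ℂ, -(1 / 3) ≤ τ'.re ∧ τ'.re ≤ 2 / 3 ∧ τ'.im = τ.im ∧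
    ‖invQuot τ'‖ = ‖invQuot τ‖ := by
  refine ⟨τ + (-⌊τ.re + 1 / 3⌋ : ℤ), ?_, ?_, ?_, norm_invQuot_add_int _ _⟩
  · have := Int.floor_le (τ.re + 1 / 3)
    rw [add_re, intCast_re]; push_cast; linarith
  · have := Int.lt_floor_add_one (τ.re + 1 / 3)
    rw [add_re, intCast_re]; push_cast; linarith
  · rw [add_im, intCast_im, add_zero]

lemma le_im_neg_inv {M : ℝ} (hM : 0 < M) {z : ℂ} (hz : 0 < z.im)
    (h : 21 / 20 * M * (z.re ^ 2 + z.im ^ 2) ≤ 1) :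
    21 / 20 * z.im ≤ (-(1 / (M * z))).im := by
  have : 0 < z.re ^ 2 + z.im ^ 2 := by positivity
  rw [one_div, mul_inv, ← ofReal_inv, neg_im, im_ofReal_mul, inv_im, normSq_apply,
    ← sq, ← sq, ← mul_neg, neg_div, neg_neg, inv_mul_eq_div, div_div, le_div_iff₀ (by positivity)]
  nlinarith [mul_le_mul_of_nonneg_left h hz.le]

/-- Below height 1/20 the strip -1/3 ≤ Re ≤ 2/3 lies inside the isometric circles of the
involutions, centred at -2/7, 0, 2/7, 1/2 with squared radii 1/98, 1/14, 1/98, 1/28. The cuts at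
-1/4, 1/4, 1/3 leave enough room for a gain of 21/20 in height. -/
lemma exists_larger_im {τ : ℂ} (hτ : 0 < τ.im) (hs : τ.im < 1 / 20) :
    ∃ τ' : ℂ, 21 / 20 * τ.im ≤ τ'.im ∧ ‖invQuot τ'‖ = ‖invQuot τ‖ := by
  obtain ⟨σ, h1, h2, h3, h4⟩ := exists_translate τ
  rw [← h3] at hτ hs ⊢
  simp only [← h4]
  clear h3 h4 τ
  have hr : ((2 : ℂ) / 7).re = 2 / 7 ∧ ((2 : ℂ) / 7).im = 0 := by
    rw [show (2 : ℂ) / 7 = ((2 / 7 : ℝ) : ℂ) by push_cast; rfl]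
    exact ⟨ofReal_re _, ofReal_im _⟩
  rcases le_or_gt σ.re (-(1 / 4)) with c1 | c1
  · have hw : 0 < (σ + 2 / 7).im := by rw [add_im, hr.2, add_zero]; exact hτ
    have hz := im_neg_inv_pos hw (M := 98) (by norm_num)
    push_cast at hz
    -- Around -2/7 the inverse of the map at 2/7 is needed.
    refine ⟨2 / 7 + -(1 / (98 * (σ + 2 / 7))), ?_, ?_⟩
    · have := le_im_neg_inv (M := 98) (by norm_num) hw (by
        rw [add_im, add_re, hr.1, hr.2, add_zero]; nlinarith)
      push_cast at this
      rw [add_im (2 / 7), hr.2, zero_add]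
      rwa [add_im, hr.2, add_zero] at this
    · rw [← norm_invQuot_two_sevenths hz]
      have := ne_zero_of_im_pos hw
      have e : -(2 / 7) - 1 / (98 * -(1 / (98 * (σ + 2 / 7)))) = σ := by
        field_simp
        ring
      rw [e]
  rcases le_or_gt σ.re (1 / 4) with c2 | c2
  · refine ⟨-1 / (14 * σ), ?_, norm_invQuot_fricke hτ⟩
    have := le_im_neg_inv (M := 14) (by norm_num) hτ (by nlinarith)
    rw [neg_div]
    exact_mod_cast this
  rcases le_or_gt σ.re (1 / 3) with c3 | c3
  · have hz : 0 < (σ - 2 / 7).im := by rw [sub_im, hr.2, sub_zero]; exact hτ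
    refine ⟨-(2 / 7) - 1 / (98 * (σ - 2 / 7)), ?_, ?_⟩
    · have := le_im_neg_inv (M := 98) (by norm_num) hz (by
        rw [sub_im, sub_re, hr.1, hr.2, sub_zero]; nlinarith)
      push_cast at this
      rw [sub_eq_add_neg, add_im, neg_im, hr.2, neg_zero, zero_add]
      rwa [sub_im, hr.2, sub_zero] at this
    · rw [norm_invQuot_two_sevenths hz, add_sub_cancel]
  · have hr' : ((1 : ℂ) / 2).re = 1 / 2 ∧ ((1 : ℂ) / 2).im = 0 := by
      rw [show (1 : ℂ) / 2 = ((1 / 2 : ℝ) : ℂ) by push_cast; rfl]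
      exact ⟨ofReal_re _, ofReal_im _⟩
    have hz : 0 < (σ - 1 / 2).im := by rw [sub_im, hr'.2, sub_zero]; exact hτ
    refine ⟨1 / 2 - 1 / (28 * (σ - 1 / 2)), ?_, ?_⟩
    · have := le_im_neg_inv (M := 28) (by norm_num) hz (by
        rw [sub_im, sub_re, hr'.1, hr'.2, sub_zero]; nlinarith)
      push_cast at this
      rw [sub_eq_add_neg, add_im, hr'.2, zero_add]
      rwa [sub_im, hr'.2, sub_zero] at this
    · rw [norm_invQuot_half hz, add_sub_cancel]

lemma exists_reduced_of_le (k : ℕ) : ∀ τ : ℂ, 0 < τ.im → 1 / 20 ≤ (21 / 20) ^ k * τ.im →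
    ∃ τ' : ℂ, |τ'.re| ≤ 1 ∧ 1 / 20 ≤ τ'.im ∧ ‖invQuot τ'‖ = ‖invQuot τ‖ := by
  have base (τ : ℂ) (h : 1 / 20 ≤ τ.im) :
      ∃ τ' : ℂ, |τ'.re| ≤ 1 ∧ 1 / 20 ≤ τ'.im ∧ ‖invQuot τ'‖ = ‖invQuot τ‖ := by
    obtain ⟨σ, h1, h2, h3, h4⟩ := exists_translate τ
    exact ⟨σ, abs_le.2 ⟨by linarith, by linarith⟩, h3 ▸ h, h4⟩
  induction k with
  | zero => exact fun τ _ h => base τ (by simpa using h)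
  | succ k ih =>
    intro τ hτ h
    rcases le_or_gt (1 / 20) τ.im with hs | hs
    · exact base τ hs
    obtain ⟨σ, h1, h2⟩ := exists_larger_im hτ hs
    obtain ⟨τ', h3, h4, h5⟩ := ih σ (by linarith) (h.trans (by
      rw [pow_succ, mul_assoc]; gcongr))
    exact ⟨τ', h3, h4, h5.trans h2⟩

lemma exists_reduced {τ : ℂ} (hτ : 0 < τ.im) :
    ∃ τ' : ℂ, |τ'.re| ≤ 1 ∧ 1 / 20 ≤ τ'.im ∧ ‖invQuot τ'‖ = ‖invQuot τ‖ := by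
  obtain ⟨k, hk⟩ := pow_unbounded_of_one_lt (1 / 20 / τ.im) (by norm_num : (1 : ℝ) < 21 / 20)
  exact exists_reduced_of_le k τ hτ ((div_le_iff₀ hτ).1 hk.le)

/-! ### Growth at i∞ -/

/-- The filter of neighbourhoods of `i∞`. -/
noncomputable def imInfty : Filter ℂ := comap Complex.im atTop

/-- The decay `|q| ^ m` at `i∞`, where `q = exp (π i τ)`. -/
noncomputable def decay (m : ℝ) (τ : ℂ) : ℝ := Real.exp (-(Real.pi * m * τ.im))

lemma decay_mul (m n : ℝ) (τ : ℂ) : decay m τ * decay n τ = decay (m + n) τ := by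
  rw [decay, decay, decay, ← Real.exp_add]
  ring_nf

lemma decay_pow (m : ℝ) (n : ℕ) (τ : ℂ) : decay m τ ^ n = decay (n * m) τ := by
  rw [decay, decay, ← Real.exp_nat_mul]
  ring_nf

lemma eventually_imInfty (r : ℝ) : ∀ᶠ τ in imInfty, r ≤ τ.im :=
  (eventually_ge_atTop r).comap _

lemma isBigO_decay {m n : ℝ} (h : n ≤ m) : decay m =O[imInfty] decay n := by
  refine .of_bound 1 ?_
  filter_upwards [eventually_imInfty 0] with τ hτ
  rw [one_mul, decay, decay, Real.norm_of_nonneg (Real.exp_pos _).le,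
    Real.norm_of_nonneg (Real.exp_pos _).le, Real.exp_le_exp, neg_le_neg_iff]
  gcongr

lemma tendsto_decay {m : ℝ} (hm : 0 < m) : Tendsto (decay m) imInfty (𝓝 0) := by
  have : Tendsto (fun y : ℝ => Real.exp (-(Real.pi * m * y))) atTop (𝓝 0) :=
    Real.tendsto_exp_neg_atTop_nhds_zero.comp (tendsto_id.const_mul_atTop (by positivity))
  exact this.comp tendsto_comap

lemma tendsto_add_one_imInfty : Tendsto (fun τ : ℂ => τ + 1) imInfty imInfty := by
  refine tendsto_comap_iff.2 ?_
  have : Complex.im ∘ (fun τ : ℂ => τ + 1) = Complex.im := by ext; simp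
  rw [this]
  exact tendsto_comap

lemma IsBigO.comp_add_one {f : ℂ → ℂ} {m : ℝ} (h : f =O[imInfty] decay m) :
    (fun τ => f (τ + 1)) =O[imInfty] decay m := by
  refine (h.comp_tendsto tendsto_add_one_imInfty).congr (fun _ => rfl) fun τ => ?_
  simp [decay]

/-- For Im τ ≥ 1 and a form value R ≥ m, (R - m)(Im τ - 1) ≥ 0. Each remaining term is thus at most
`decay m τ` times exp(πm)exp(-πR), which is summable independently of τ. -/
lemma charTheta_sub_sum_isBigO {a b c : ℤ} (ha : 0 < a) (hD : 0 < a * c - b ^ 2) (ε δ : ℤ)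
    (S : Finset (ℤ × ℤ)) {m : ℝ} (h : ∀ p : ℤ × ℤ, p ∉ S →
      m ≤ a * (p.1 : ℝ) ^ 2 + 2 * b * p.1 * (p.2 + δ / 2) + c * ((p.2 : ℝ) + δ / 2) ^ 2) :
    (fun τ => charTheta a b c ε δ τ - ∑ p ∈ S, cexp (Real.pi * I * ε * p.1 + Real.pi * I * τ *
      (a * p.1 ^ 2 + 2 * b * p.1 * (p.2 + δ / 2) + c * (p.2 + δ / 2) ^ 2)))
      =O[imInfty] decay m := by
  have ha' : (0 : ℝ) < a := by exact_mod_cast ha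
  have hD' : (0 : ℝ) < a * c - b ^ 2 := by exact_mod_cast hD
  have hn (τ : ℂ) (p : ℤ × ℤ) : ‖cexp (Real.pi * I * ε * p.1 + Real.pi * I * τ *
      (a * p.1 ^ 2 + 2 * b * p.1 * (p.2 + δ / 2) + c * (p.2 + δ / 2) ^ 2))‖ =
      Real.exp (-Real.pi * τ.im * (a * (p.1 : ℝ) ^ 2 + 2 * b * p.1 * (p.2 + δ / 2) +
        c * ((p.2 : ℝ) + δ / 2) ^ 2)) := by
    have := norm_cexp_binTheta a b c (ε / 2) 0 0 (δ / 2) p.1 p.2 τ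
    rw [add_zero] at this
    rw [← this]
    congr 2
    push_cast
    ring
  have hs0 : Summable fun p : ℤ × ℤ => Real.exp (-Real.pi * (a * (p.1 : ℝ) ^ 2 +
      2 * b * p.1 * (p.2 + δ / 2) + c * ((p.2 : ℝ) + δ / 2) ^ 2)) := by
    simpa using summable_exp_neg_quadForm ha' hD' 0 (δ / 2) Real.pi_pos
  have hsub : Summable fun p : {p // p ∉ S} => Real.exp (-Real.pi * (a * (p.1.1 : ℝ) ^ 2 +
      2 * b * p.1.1 * (p.1.2 + δ / 2) + c * ((p.1.2 : ℝ) + δ / 2) ^ 2)) :=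
    hs0.comp_injective Subtype.val_injective
  refine .of_bound (Real.exp (Real.pi * m) * ∑' p : {p // p ∉ S}, Real.exp (-Real.pi *
    (a * (p.1.1 : ℝ) ^ 2 + 2 * b * p.1.1 * (p.1.2 + δ / 2) + c * ((p.1.2 : ℝ) + δ / 2) ^ 2))) ?_
  filter_upwards [eventually_imInfty 1] with τ hτ
  have hs : Summable fun p : ℤ × ℤ => cexp (Real.pi * I * ε * p.1 + Real.pi * I * τ *
      (a * p.1 ^ 2 + 2 * b * p.1 * (p.2 + δ / 2) + c * (p.2 + δ / 2) ^ 2)) := by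
    refine Summable.of_norm ?_
    simp only [hn]
    refine hs0.of_nonneg_of_le (fun _ => (Real.exp_pos _).le) fun p => ?_
    obtain ⟨r, hr, hQ⟩ := exists_quadForm_ge ha' hD'
    have h0 := (by positivity : 0 ≤ r * ((p.1 : ℝ) ^ 2 + (p.2 + δ / 2) ^ 2)).trans (hQ _ _)
    rw [Real.exp_le_exp, neg_mul, neg_mul, neg_mul, neg_le_neg_iff]
    gcongr
    exact le_mul_of_one_le_right Real.pi_pos.le hτ
  rw [charTheta_eq, ← hs.sum_add_tsum_subtype_compl S, add_sub_cancel_left,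
    Real.norm_of_nonneg (by exact (Real.exp_pos _).le)]
  refine (tsum_of_norm_bounded (hsub.hasSum.mul_left (Real.exp (Real.pi * m) * decay m τ))
    fun p => ?_).trans_eq (by ring)
  rw [hn, decay, ← Real.exp_add, ← Real.exp_add, Real.exp_le_exp]
  nlinarith [mul_le_mul_of_nonneg_left (h p.1 p.2) (mul_nonneg Real.pi_pos.le (sub_nonneg.2 hτ))]

lemma charTheta_isBigO {a b c : ℤ} (ha : 0 < a) (hD : 0 < a * c - b ^ 2) (ε δ : ℤ) {m : ℝ}
    (h : ∀ x y : ℤ, m ≤ a * (x : ℝ) ^ 2 + 2 * b * x * (y + δ / 2) + c * ((y : ℝ) + δ / 2) ^ 2) :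
    charTheta a b c ε δ =O[imInfty] decay m := by
  simpa using charTheta_sub_sum_isBigO ha hD ε δ ∅ fun p _ => h p.1 p.2

lemma charTheta_sub_one_isBigO {a b c : ℤ} (ha : 0 < a) (hD : 0 < a * c - b ^ 2) {m : ℝ}
    (h : ∀ x y : ℤ, ¬ (x = 0 ∧ y = 0) → m ≤ ((a * x ^ 2 + 2 * b * x * y + c * y ^ 2 : ℤ) : ℝ)) :
    (fun τ => charTheta a b c 0 0 τ - 1) =O[imInfty] decay m := by
  have := charTheta_sub_sum_isBigO ha hD 0 0 {0} (m := m) fun p hp => by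
    have := h p.1 p.2 (by rwa [Finset.mem_singleton, Prod.ext_iff] at hp)
    push_cast at this ⊢
    rwa [zero_div, add_zero]
  simpa using this

lemma thetaA_sub_isBigO :
    (fun τ => thetaA 0 0 τ - (1 + 2 * cexp (Real.pi * I * τ))) =O[imInfty] decay 2 := by
  have := charTheta_sub_sum_isBigO (a := 1) (b := 0) (c := 14) (by norm_num) (by norm_num) 0 0
    {(0, 0), (1, 0), (-1, 0)} (m := 2) fun p hp => by
      obtain ⟨x, y⟩ := p
      simp only [Finset.mem_insert, Finset.mem_singleton, Prod.mk.injEq] at hp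
      have : (2 : ℤ) ≤ x ^ 2 + 14 * y ^ 2 := by
        rcases eq_or_ne y 0 with rfl | hy
        · have : 2 ≤ x ∨ x ≤ -2 := by omega
          rcases this with h | h <;> nlinarith
        · have := Int.one_le_abs hy
          have h2 : (1 : ℤ) ≤ y ^ 2 := by rw [← sq_abs]; nlinarith
          nlinarith [sq_nonneg x]
      have h3 : (2 : ℝ) ≤ (x : ℝ) ^ 2 + 14 * (y : ℝ) ^ 2 := by exact_mod_cast this
      push_cast
      simpa using h3
  refine this.congr_left fun τ => ?_
  rw [thetaA, Finset.sum_insert (by decide), Finset.sum_insert (by decide), Finset.sum_singleton]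
  simp only [Int.cast_zero, Int.cast_one, Int.cast_neg]
  simp
  ring

lemma thetaB_sub_isBigO : (fun τ => thetaB 0 0 τ - 1) =O[imInfty] decay 2 := by
  refine charTheta_sub_one_isBigO (by norm_num) (by norm_num) fun x y h => ?_
  have : (2 : ℤ) ≤ 7 * x ^ 2 + 2 * 0 * x * y + 2 * y ^ 2 := by
    rcases eq_or_ne y 0 with rfl | hy
    · have : x ≠ 0 := by tauto
      have := Int.one_le_abs this
      have h2 : (1 : ℤ) ≤ x ^ 2 := by rw [← sq_abs]; nlinarith
      nlinarith
    · have := Int.one_le_abs hy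
      have h2 : (1 : ℤ) ≤ y ^ 2 := by rw [← sq_abs]; nlinarith
      nlinarith [sq_nonneg x]
  exact_mod_cast this

lemma thetaC_sub_isBigO : (fun τ => thetaC 0 0 τ - 1) =O[imInfty] decay 2 := by
  refine charTheta_sub_one_isBigO (by norm_num) (by norm_num) fun x y h => ?_
  have : (2 : ℤ) ≤ 5 * x ^ 2 + 2 * (-14) * x * y + 42 * y ^ 2 := by
    rcases eq_or_ne y 0 with rfl | hy
    · have : x ≠ 0 := by tauto
      have := Int.one_le_abs this
      have h2 : (1 : ℤ) ≤ x ^ 2 := by rw [← sq_abs]; nlinarith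
      nlinarith
    · have := Int.one_le_abs hy
      have h2 : (1 : ℤ) ≤ y ^ 2 := by rw [← sq_abs]; nlinarith
      nlinarith [sq_nonneg (5 * x - 14 * y)]
  exact_mod_cast this

lemma one_le_two_mul_add_one_sq (y : ℤ) : (1 : ℝ) ≤ (2 * y + 1) ^ 2 := by
  have h : (2 * y + 1 : ℤ) ≠ 0 := by omega
  have := Int.one_le_abs h
  have h2 : (1 : ℤ) ≤ (2 * y + 1) ^ 2 := by rw [← sq_abs]; nlinarith
  exact_mod_cast h2

lemma thetaA_zero_one_isBigO : thetaA 0 1 =O[imInfty] decay (3 / 2) := by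
  refine charTheta_isBigO (by norm_num) (by norm_num) 0 1 fun x y => ?_
  push_cast
  nlinarith [one_le_two_mul_add_one_sq y, sq_nonneg (x : ℝ)]

lemma thetaB_zero_one_isBigO : thetaB 0 1 =O[imInfty] decay (1 / 2) := by
  refine charTheta_isBigO (by norm_num) (by norm_num) 0 1 fun x y => ?_
  push_cast
  nlinarith [one_le_two_mul_add_one_sq y, sq_nonneg (x : ℝ)]

lemma thetaC_zero_one_isBigO : thetaC 0 1 =O[imInfty] decay (3 / 2) := by
  refine charTheta_isBigO (by norm_num) (by norm_num) 0 1 fun x y => ?_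
  -- The right side is ten times the form at (x, y + 1/2). If |2y + 1| = 1 the first square is at
  -- least 4, because 5x ∓ 7 cannot be 0 or ±1; otherwise the second square is at least 9.
  have : (15 : ℤ) ≤ 2 * (5 * x - 14 * y - 7) ^ 2 + 7 * (2 * y + 1) ^ 2 := by
    by_cases h : y = 0 ∨ y = -1
    · have h2 : 2 ≤ |5 * x - 14 * y - 7| := by
        rw [le_abs]
        rcases h with rfl | rfl <;> omega
      have h3 : (4 : ℤ) ≤ (5 * x - 14 * y - 7) ^ 2 := by rw [← sq_abs]; nlinarith
      rcases h with rfl | rfl <;> nlinarith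
    · have h2 : 3 ≤ 2 * y + 1 ∨ 2 * y + 1 ≤ -3 := by omega
      have h3 : (9 : ℤ) ≤ (2 * y + 1) ^ 2 := by rcases h2 with h2 | h2 <;> nlinarith
      nlinarith [sq_nonneg (5 * x - 14 * y - 7)]
  have : (15 : ℝ) ≤ 2 * (5 * x - 14 * y - 7) ^ 2 + 7 * (2 * y + 1) ^ 2 := by exact_mod_cast this
  push_cast
  nlinarith

lemma norm_cexp_pi_mul (c : ℝ) (τ : ℂ) : ‖cexp (Real.pi * I * (c * τ))‖ = decay c τ := by
  rw [Complex.norm_exp, decay]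
  congr 1
  rw [show (Real.pi * I * (c * τ) : ℂ) = ((Real.pi * c : ℝ) : ℂ) * (I * τ) by push_cast; ring,
    re_ofReal_mul, I_mul_re]
  ring

lemma tendsto_cexp_imInfty {c : ℝ} (hc : 0 < c) :
    Tendsto (fun τ : ℂ => cexp (Real.pi * I * (c * τ))) imInfty (𝓝 0) := by
  rw [tendsto_zero_iff_norm_tendsto_zero]
  simp only [norm_cexp_pi_mul]
  exact tendsto_decay hc

lemma tendsto_eulerProd_cexp {c : ℝ} (hc : 0 < c) :
    Tendsto (fun τ : ℂ => eulerProd (cexp (2 * Real.pi * I * (c * τ)))) imInfty (𝓝 1) := by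
  have h := (differentiableOn_eulerProd.differentiableAt
    (Metric.isOpen_ball.mem_nhds (Metric.mem_ball_self one_pos))).continuousAt.tendsto
  rw [eulerProd_zero] at h
  refine (h.comp (tendsto_cexp_imInfty (c := 2 * c) (by positivity))).congr fun τ => ?_
  rw [Function.comp_apply]
  congr 2
  push_cast
  ring

/-- The quotient of Euler products in `etaQuot`, as a function of `q = exp (π i τ)`. -/
noncomputable def eulerQuot (q : ℂ) : ℂ :=
  (eulerProd (q ^ 28) * eulerProd (q ^ 2) / (eulerProd (q ^ 14) * eulerProd (q ^ 4))) ^ 2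

lemma etaQuot_eq (τ : ℂ) :
    etaQuot τ = cexp (Real.pi * I * τ) * eulerQuot (cexp (Real.pi * I * τ)) := by
  unfold etaQuot eulerQuot
  simp only [← Complex.exp_nat_mul]
  congr 4 <;> congr 2 <;> push_cast <;> ring_nf

lemma eulerQuot_sub_one_isBigO : (fun q => eulerQuot q - 1) =O[𝓝 0] fun q : ℂ => q := by
  have h (n : ℕ) : DifferentiableAt ℂ (fun q : ℂ => eulerProd (q ^ (n + 1))) 0 := by
    refine DifferentiableAt.comp (g := eulerProd) 0 ?_ (by fun_prop)
    rw [zero_pow (Nat.succ_ne_zero n)]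
    exact differentiableOn_eulerProd.differentiableAt
      (Metric.isOpen_ball.mem_nhds (Metric.mem_ball_self one_pos))
  have hd : DifferentiableAt ℂ eulerQuot 0 :=
    ((((h 27).mul (h 1)).div ((h 13).mul (h 3)) (by simp [eulerProd_zero])).pow 2)
  have := hd.isBigO_sub
  simpa [eulerQuot, eulerProd_zero] using this

lemma cexp_isBigO : (fun τ => cexp (Real.pi * I * τ)) =O[imInfty] decay 1 := by
  refine .of_bound 1 (.of_forall fun τ => ?_)
  have := norm_cexp_pi_mul 1 τ
  rw [ofReal_one, one_mul] at this
  rw [this, one_mul, Real.norm_of_nonneg (by exact (Real.exp_pos _).le)]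

lemma etaQuot_sub_isBigO :
    (fun τ => etaQuot τ - cexp (Real.pi * I * τ)) =O[imInfty] decay 2 := by
  have h := tendsto_cexp_imInfty one_pos
  simp only [ofReal_one, one_mul] at h
  have h2 := cexp_isBigO.mul ((eulerQuot_sub_one_isBigO.comp_tendsto h).trans cexp_isBigO)
  refine h2.congr (fun τ => ?_) fun τ => ?_
  · rw [etaQuot_eq, Function.comp_apply]
    ring
  · rw [decay_mul]
    norm_num

lemma etaQuot_isBigO : etaQuot =O[imInfty] decay 1 := by
  refine ((etaQuot_sub_isBigO.trans (isBigO_decay (by norm_num))).add cexp_isBigO).congr_left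
    fun τ => ?_
  ring

/-- A - C = 2q + O(q²) and h(B + C) = 2q + O(q²), so the linear terms cancel. This cancellation is
indispensable: with order 1 for this defect and its translate, the available bounds would give the
product only order 5, short of the 6 consumed by the denominators. -/
lemma defect₀₀_isBigO : defect₀₀ =O[imInfty] decay 2 := by
  have h1 := thetaB_sub_isBigO.add thetaC_sub_isBigO
  have h2 : (fun τ => etaQuot τ * (thetaB 0 0 τ - 1 + (thetaC 0 0 τ - 1))) =O[imInfty] decay 2 :=
    ((etaQuot_isBigO.mul h1).congr_right fun τ => decay_mul 1 2 τ).trans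
      (isBigO_decay (by norm_num))
  have h3 := ((thetaA_sub_isBigO.sub thetaC_sub_isBigO).sub h2).sub
    (etaQuot_sub_isBigO.const_mul_left 2)
  refine h3.congr_left fun τ => ?_
  rw [defect₀₀]
  ring

lemma defect₁₀_isBigO : defect₁₀ =O[imInfty] decay 2 :=
  (IsBigO.comp_add_one defect₀₀_isBigO).congr_left fun τ => defect₀₀_add_one τ

lemma defect₀₁_isBigO : defect₀₁ =O[imInfty] decay (3 / 2) := by
  have h2 : (fun τ => etaQuot τ * (thetaB 0 1 τ + thetaC 0 1 τ)) =O[imInfty] decay (3 / 2) :=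
    (etaQuot_isBigO.mul (thetaB_zero_one_isBigO.add (thetaC_zero_one_isBigO.trans
      (isBigO_decay (by norm_num))))).congr_right fun τ => by rw [decay_mul]; norm_num
  exact (thetaA_zero_one_isBigO.sub thetaC_zero_one_isBigO).add h2

lemma defect₁₁_isBigO : defect₁₁ =O[imInfty] decay (3 / 2) :=
  ((IsBigO.comp_add_one defect₀₁_isBigO).const_mul_left I).congr_left fun τ => by
    rw [defect₀₁_add_one]
    linear_combination -defect₁₁ τ * I_sq

lemma defectProd_isBigO : defectProd =O[imInfty] decay 7 :=
  (((defect₀₀_isBigO.mul defect₁₀_isBigO).mul defect₀₁_isBigO).mul defect₁₁_isBigO).congr_right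
    fun τ => by simp only [decay_mul]; norm_num

/-- Orders in q: the numerator has at least 12 · 7 = 84, `etaQuot ^ 24` has 24, and `discProd` has
2(1 + 2 + 7 + 14) = 48. A surplus of 12 remains, and the Euler products tend to 1. -/
lemma tendsto_invQuot : Tendsto invQuot imInfty (𝓝 0) := by
  have t1 := tendsto_eulerProd_cexp one_pos
  have t2 := tendsto_eulerProd_cexp two_pos
  have t7 := tendsto_eulerProd_cexp (c := 7) (by norm_num)
  have t14 := tendsto_eulerProd_cexp (c := 14) (by norm_num)
  push_cast at t1 t2 t7 t14
  simp only [one_mul] at t1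
  have hu := ((t14.mul t1).div (t7.mul t2) (by norm_num)).pow 48
  have hv := ((t1.mul t2).mul (t7.mul t14)).pow 24
  have hw := (hu.mul hv).inv₀ (by norm_num)
  have hw' := hw.isBigO_one ℝ
  have hP := (defectProd_isBigO.pow 12).mul hw'
  have hq : Tendsto (decay 12) imInfty (𝓝 0) := tendsto_decay (by norm_num)
  have hE : (fun τ => (cexp (Real.pi * I * (72 * τ)))⁻¹) =O[imInfty] decay (-72) := by
    refine .of_bound 1 (.of_forall fun τ => ?_)
    have := norm_cexp_pi_mul 72 τ
    rw [ofReal_ofNat] at this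
    rw [norm_inv, this, one_mul, Real.norm_of_nonneg (by exact (Real.exp_pos _).le), decay, decay,
      ← Real.exp_neg]
    ring_nf
    rfl
  refine IsBigO.trans_tendsto ((hP.mul hE).congr (fun τ => ?_) fun τ => ?_) hq
  · have e1 : cexp (Real.pi * I * τ) ^ 24 * (cexp (2 * Real.pi * I * τ) *
        cexp (2 * Real.pi * I * (2 * τ)) * (cexp (2 * Real.pi * I * (7 * τ)) *
        cexp (2 * Real.pi * I * (14 * τ)))) = cexp (Real.pi * I * (72 * τ)) := by
      rw [← Complex.exp_nat_mul, ← Complex.exp_add, ← Complex.exp_add, ← Complex.exp_add,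
        ← Complex.exp_add]
      congr 1
      push_cast
      ring
    rw [← e1, Pi.div_apply]
    unfold invQuot etaQuot discProd discFun
    generalize eulerProd (cexp (2 * Real.pi * I * (2 * τ))) = x2
    generalize eulerProd (cexp (2 * Real.pi * I * (7 * τ))) = x7
    generalize eulerProd (cexp (2 * Real.pi * I * (14 * τ))) = x14
    generalize eulerProd (cexp (2 * Real.pi * I * τ)) = x1
    generalize cexp (2 * Real.pi * I * (2 * τ)) = y2
    generalize cexp (2 * Real.pi * I * (7 * τ)) = y7
    generalize cexp (2 * Real.pi * I * (14 * τ)) = y14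
    generalize cexp (2 * Real.pi * I * τ) = y1
    generalize cexp (Real.pi * I * τ) = y
    generalize defectProd τ = d
    ring
  · rw [decay_pow, mul_one, decay_mul]
    norm_num

/-! ### Vanishing by the maximum principle -/

lemma im_pos_of_ge {τ : ℂ} (h : 1 / 20 ≤ τ.im) : 0 < τ.im := lt_of_lt_of_le (by norm_num) h

lemma invQuot_eq_zero {τ : ℂ} (hτ : 0 < τ.im) : invQuot τ = 0 := by
  by_contra h0
  have hpos : 0 < ‖invQuot τ‖ := norm_pos_iff.2 h0
  have hev : ∀ᶠ σ in imInfty, ‖invQuot σ‖ < ‖invQuot τ‖ := by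
    have := tendsto_invQuot.norm
    rw [norm_zero] at this
    exact this.eventually_lt_const hpos
  obtain ⟨Y, hY⟩ : ∃ Y : ℝ, ∀ σ : ℂ, Y ≤ σ.im → ‖invQuot σ‖ < ‖invQuot τ‖ := by
    obtain ⟨s, hs, hs'⟩ := mem_comap.1 hev
    obtain ⟨Y, hY⟩ := mem_atTop_sets.1 hs
    exact ⟨Y, fun σ hσ => hs' (hY _ hσ)⟩
  obtain ⟨τ₁, h1, h2, h3⟩ := exists_reduced hτ
  -- Reduced points at which the modulus is at least its value at τ lie below height Y, hence in a
  -- compact rectangle. A maximum there is a maximum over the whole half-plane, by reduction.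
  obtain ⟨K, hK, hKim, hmem⟩ : ∃ K : Set ℂ, IsCompact K ∧ (∀ σ ∈ K, 0 < σ.im) ∧
      ∀ σ : ℂ, |σ.re| ≤ 1 → 1 / 20 ≤ σ.im → ‖invQuot τ‖ ≤ ‖invQuot σ‖ → σ ∈ K := by
    refine ⟨Set.Icc (-1 : ℝ) 1 ×ℂ Set.Icc (1 / 20 : ℝ) Y, isCompact_Icc.reProdIm isCompact_Icc,
      fun σ hσ => im_pos_of_ge (mem_reProdIm.1 hσ).2.1, fun σ a b c => mem_reProdIm.2
        ⟨abs_le.1 a, b, ?_⟩⟩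
    by_contra! hc
    exact (hY σ hc.le).not_ge c
  have hcont : ContinuousOn (fun σ => ‖invQuot σ‖) K :=
    (differentiableOn_invQuot.continuousOn.mono hKim).norm
  obtain ⟨c, hc, hmax⟩ := hK.exists_isMaxOn ⟨τ₁, hmem _ h1 h2 h3.ge⟩ hcont
  have hc0 : 0 < c.im := hKim c hc
  have hτc : ‖invQuot τ‖ ≤ ‖invQuot c‖ := h3.symm.le.trans (hmax (hmem _ h1 h2 h3.ge))
  have hle : ∀ σ : ℂ, 0 < σ.im → ‖invQuot σ‖ ≤ ‖invQuot c‖ := fun σ hσ => by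
    rcases le_or_gt ‖invQuot σ‖ ‖invQuot τ‖ with h | h
    · exact h.trans hτc
    · obtain ⟨σ', a, b, e⟩ := exists_reduced hσ
      rw [← e] at h ⊢
      exact hmax (hmem _ a b h.le)
  have hconst : ∀ σ : ℂ, 0 < σ.im → invQuot σ = invQuot c := fun σ hσ =>
    Complex.eqOn_of_isPreconnected_of_isMaxOn_norm (U := {τ : ℂ | 0 < τ.im})
      (convex_halfSpace_im_gt 0).isPreconnected (isOpen_lt continuous_const continuous_im)
      differentiableOn_invQuot hc0 (fun z hz => hle z hz) hσ
  -- The function is constant, yet strictly smaller in modulus above height Y; the 1 keeps the point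
  -- in the half-plane.
  have := hY (max Y 1 * I) (by simp)
  rw [hconst (max Y 1 * I) (by simp), ← hconst τ hτ] at this
  exact lt_irrefl _ this

lemma defectProd_eq_zero {τ : ℂ} (hτ : 0 < τ.im) : defectProd τ = 0 := by
  have h := invQuot_eq_zero hτ
  rw [invQuot, div_eq_zero_iff, or_iff_left (discProd_ne_zero hτ)] at h
  have h2 := pow_eq_zero_iff (by norm_num : 12 ≠ 0) |>.1 h
  rwa [div_eq_zero_iff, or_iff_left (pow_ne_zero 2 (etaQuot_ne_zero hτ))] at h2

lemma eq_zero_or_eq_zero_of_mul {f g : ℂ → ℂ} (hf : DifferentiableOn ℂ f {τ | 0 < τ.im})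
    (hg : DifferentiableOn ℂ g {τ | 0 < τ.im}) (h : ∀ τ : ℂ, 0 < τ.im → f τ * g τ = 0) :
    (∀ τ : ℂ, 0 < τ.im → f τ = 0) ∨ ∀ τ : ℂ, 0 < τ.im → g τ = 0 := by
  have ho : IsOpen {τ : ℂ | 0 < τ.im} := isOpen_lt continuous_const continuous_im
  exact AnalyticOnNhd.eq_zero_or_eq_zero_of_mul_eq_zero (hf.analyticOnNhd ho)
    (hg.analyticOnNhd ho) h (convex_halfSpace_im_gt 0).isPreconnected

/-- Holomorphic functions on a connected open set have no zero divisors, so one of the four defects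
vanishes identically. The chain 11 → 01 → 10 → 00 (translation, Fricke, translation) carries the
vanishing to the required one. -/
theorem defect₀₀_eq_zero {τ : ℂ} (hτ : 0 < τ.im) : defect₀₀ τ = 0 := by
  have key : ∀ τ : ℂ, 0 < τ.im → defect₀₀ τ = 0 := by
    have d0 := differentiableOn_defect₀₀
    have d1 := differentiableOn_defect₁₀
    have d2 := differentiableOn_defect₀₁
    have d3 := differentiableOn_defect₁₁
    have of10 (h : ∀ τ : ℂ, 0 < τ.im → defect₁₀ τ = 0) (τ : ℂ) (hτ : 0 < τ.im) :
        defect₀₀ τ = 0 := by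
      rw [← defect₁₀_add_one]
      exact h _ (by simpa using hτ)
    have of01 (h : ∀ τ : ℂ, 0 < τ.im → defect₀₁ τ = 0) : ∀ τ : ℂ, 0 < τ.im → defect₀₀ τ = 0 :=
      of10 fun τ hτ => by rw [defect₁₀_fricke hτ, h _ (im_fricke_pos hτ), mul_zero]
    rcases eq_zero_or_eq_zero_of_mul ((d0.mul d1).mul d2) d3 fun τ hτ => defectProd_eq_zero hτ
      with h | h
    · rcases eq_zero_or_eq_zero_of_mul (d0.mul d1) d2 h with h | h
      · rcases eq_zero_or_eq_zero_of_mul d0 d1 h with h | h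
        · exact h
        · exact of10 h
      · exact of01 h
    · refine of01 fun τ hτ => ?_
      have h1 := h (τ + 1) (by simpa using hτ)
      rw [defect₁₁_add_one] at h1
      exact (mul_eq_zero.1 h1).resolve_left (neg_ne_zero.2 I_ne_zero)
  exact key τ hτ

/-! ### The pentagonal number theorem -/

lemma norm_prod_one_sub_pow_le {x : ℂ} (hx : ‖x‖ < 1) (k n : ℕ) :
    ‖∏ i ∈ Finset.range n, (1 - x ^ (k + i + 1))‖ ≤ Real.exp (∑' i : ℕ, ‖x‖ ^ i) := by
  have hs := summable_geometric_of_lt_one (norm_nonneg x) hx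
  rw [norm_prod]
  calc ∏ i ∈ Finset.range n, ‖1 - x ^ (k + i + 1)‖
      ≤ ∏ i ∈ Finset.range n, Real.exp (‖x‖ ^ i) := by
        refine Finset.prod_le_prod (fun _ _ => norm_nonneg _) fun i _ => ?_
        refine (norm_sub_le _ _).trans ?_
        rw [norm_one, norm_pow, add_comm]
        refine le_trans ?_ (Real.add_one_le_exp _)
        gcongr ?_ + 1
        exact pow_le_pow_of_le_one (norm_nonneg _) hx.le (by omega)
    _ = Real.exp (∑ i ∈ Finset.range n, ‖x‖ ^ i) := (Real.exp_sum _ _).symm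
    _ ≤ _ := Real.exp_le_exp.2 (hs.sum_le_tsum _ fun _ _ => by positivity)

/-- With u = n(n+1)/2 and v = n(n-1)/2, the exponent is u + 2v = n(3n-1)/2, and the sign exponent u
+ v = n² has the parity of n. -/
lemma ramanujanTheta_term (x : ℂ) (n : ℤ) :
    (-x) ^ (n * (n + 1) / 2).toNat * (-x ^ 2) ^ (n * (n - 1) / 2).toNat =
      (Int.negOnePow n : ℂ) * x ^ pentagonal n := by
  obtain ⟨u, hu⟩ : ∃ u : ℕ, n * (n + 1) = 2 * u := by
    obtain ⟨k, hk⟩ := Int.even_mul_succ_self n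
    have : 0 ≤ n * (n + 1) := by rcases le_or_gt 0 n with h | h <;> nlinarith
    exact ⟨k.toNat, by omega⟩
  obtain ⟨v, hv⟩ : ∃ v : ℕ, n * (n - 1) = 2 * v := by
    obtain ⟨k, hk⟩ := Int.even_mul_pred_self n
    have : 0 ≤ n * (n - 1) := by rcases le_or_gt 1 n with h | h <;> nlinarith
    exact ⟨k.toNat, by omega⟩
  have hp : pentagonal n = u + 2 * v := by
    have := two_mul_natCast_pentagonal n
    have : (2 * pentagonal n : ℤ) = 2 * (u + 2 * v : ℕ) := by
      rw [this]; push_cast; linarith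
    omega
  have hsign : (Int.negOnePow n : ℂ) = (-1) ^ (u + v) := by
    have h2 : Int.negOnePow ((u + v : ℕ) : ℤ) = Int.negOnePow n := by
      rw [Int.negOnePow_eq_iff]
      refine ⟨v, ?_⟩
      push_cast
      linarith
    rw [← h2, Int.coe_negOnePow, Int.natAbs_natCast]
  rw [hu, hv, Int.mul_ediv_cancel_left _ two_ne_zero, Int.mul_ediv_cancel_left _ two_ne_zero,
    Int.toNat_natCast, Int.toNat_natCast, hp, hsign, neg_pow, neg_pow (x ^ 2), pow_add, pow_add,
    ← pow_mul]
  ring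

lemma summable_norm_ramanujanTheta {x : ℂ} (hx : ‖x‖ < 1) :
    Summable fun n : ℤ =>
      ‖(-x) ^ (n * (n + 1) / 2).toNat * (-x ^ 2) ^ (n * (n - 1) / 2).toNat‖ := by
  refine ((summable_geometric_of_lt_one (norm_nonneg x) hx).comp_injective
    pentagonal_injective).congr fun n => ?_
  rw [ramanujanTheta_term, norm_mul, norm_pow, Int.coe_negOnePow, norm_pow, norm_neg, norm_one,
    one_pow, one_mul]
  rfl

/-- Euler's pentagonal number theorem in the unit disc. -/
theorem eulerE_eq_eulerProd {x : ℂ} (hx : ‖x‖ < 1) : eulerE x = eulerProd x := by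
  have h : HasSum (fun k : ℤ => (Int.negOnePow k : ℂ) * x ^ pentagonal k) (eulerE x) := by
    have := (summable_norm_ramanujanTheta hx).of_norm.hasSum
    rw [eulerE, ramanujanTheta]
    simpa only [ramanujanTheta_term] using this
  -- After n ↦ -n the index k ≥ 0 is paired with -(k + 1), whose sign is opposite.
  have h' : HasSum (fun k : ℕ => (-1) ^ k * (x ^ pentagonal (-k) - x ^ pentagonal (k + 1)))
      (eulerE x) := by
    rw [← neg_injective.hasSum_iff (fun x hx => by absurd hx; use -x; simp)] at h
    convert h.nat_add_neg_add_one using 2 with k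
    simp_rw [Function.comp_apply, neg_neg, Int.negOnePow_add]
    simp
    ring
  have hg := summable_geometric_of_lt_one (norm_nonneg x) hx
  set K := Real.exp (∑' i : ℕ, ‖x‖ ^ i)
  have hb (k n : ℕ) : ‖x ^ ((k + 1) * n) * ∏ i ∈ Finset.range (n + 1), (1 - x ^ (k + i + 1))‖ ≤
      ‖x‖ ^ n * K := by
    rw [norm_mul, norm_pow]
    refine mul_le_mul (pow_le_pow_of_le_one (norm_nonneg _) hx.le ?_)
      (norm_prod_one_sub_pow_le hx k _) (norm_nonneg _) (by positivity)
    exact Nat.le_mul_of_pos_left _ k.succ_pos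
  rw [← h'.tsum_eq, eulerProd]
  refine (Pentagonal.tprod_one_sub_pow ?_ (fun k => ?_) (fun k => ?_) h'.summable ?_).symm
  · exact tendsto_pow_atTop_nhds_zero_of_norm_lt_one hx
  · exact (hg.mul_right K).of_norm_bounded (hb k)
  · have hs : Summable fun n : ℕ => ‖-x ^ (n + k + 1)‖ := by
      simp_rw [norm_neg, norm_pow, add_assoc]
      exact (summable_nat_add_iff (k + 1)).2 hg
    simpa [sub_eq_add_neg] using multipliable_one_add_of_summable hs
  -- The remainder after k steps: its power of x has exponent at least k, and the series it
  -- multiplies is bounded uniformly in k.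
  · refine squeeze_zero_norm (a := fun k : ℕ => ‖x‖ ^ k * ∑' n : ℕ, ‖x‖ ^ n * K)
      (fun k => ?_) ?_
    · rw [norm_mul, norm_mul, norm_pow, norm_neg, norm_one, one_pow, one_mul, norm_pow]
      refine mul_le_mul (pow_le_pow_of_le_one (norm_nonneg _) hx.le ?_)
        (tsum_of_norm_bounded (hg.mul_right K).hasSum (hb k)) (norm_nonneg _) (by positivity)
      rw [Nat.le_div_iff_mul_le two_pos]
      nlinarith
    · have := (tendsto_pow_atTop_nhds_zero_of_lt_one (norm_nonneg x) hx).mul_const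
        (∑' n : ℕ, ‖x‖ ^ n * K)
      rwa [zero_mul] at this

/-! ### From theta functions back to series in q -/

section form

variable {a b c : ℤ} (ha : 0 < a) (hD : b ^ 2 < 4 * a * c)
include ha hD

lemma form_pos {x y : ℤ} (h : ¬ (x = 0 ∧ y = 0)) : 0 < a * x ^ 2 + b * x * y + c * y ^ 2 := by
  have e : 4 * a * (a * x ^ 2 + b * x * y + c * y ^ 2) =
      (2 * a * x + b * y) ^ 2 + (4 * a * c - b ^ 2) * y ^ 2 := by ring
  rcases eq_or_ne y 0 with rfl | hy
  · have hx : x ≠ 0 := by tauto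
    have : 0 < x ^ 2 := by positivity
    nlinarith
  · have h1 : 0 < y ^ 2 := by positivity
    have h2 : 0 < 4 * a * (a * x ^ 2 + b * x * y + c * y ^ 2) := by
      rw [e]; nlinarith [sq_nonneg (2 * a * x + b * y)]
    exact pos_of_mul_pos_right h2 (by positivity)

lemma form_nonneg (x y : ℤ) : 0 ≤ a * x ^ 2 + b * x * y + c * y ^ 2 := by
  by_cases h : x = 0 ∧ y = 0
  · simp [h.1, h.2]
  · exact (form_pos ha hD h).le

lemma formSeries_zero : formSeries a b c 0 = 1 := by
  unfold formSeries
  rw [tsum_eq_single (0, 0)]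
  · simp
  · intro p hp
    have := form_pos ha hD (x := p.1) (y := p.2) fun h => hp (Prod.ext h.1 h.2)
    exact zero_pow (by omega)

lemma summable_norm_formSeries {q : ℂ} (hq : ‖q‖ < 1) :
    Summable fun p : ℤ × ℤ => ‖q ^ (a * p.1 ^ 2 + b * p.1 * p.2 + c * p.2 ^ 2).toNat‖ := by
  -- Bounding ‖q‖ by a positive ρ < 1 allows ρ^n = exp(n log ρ) even when q = 0.
  set ρ := max ‖q‖ (1 / 2)
  have h0 : 0 < ρ := lt_max_of_lt_right (by norm_num)
  have h1 : ρ < 1 := max_lt hq (by norm_num)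
  have hr : 0 < -Real.log ρ := neg_pos.2 (Real.log_neg h0 h1)
  have ha' : (0 : ℝ) < a := by exact_mod_cast ha
  have hD' : (0 : ℝ) < a * c - (b / 2 : ℝ) ^ 2 := by
    have : (b : ℝ) ^ 2 < 4 * a * c := by exact_mod_cast hD
    linarith
  refine (summable_exp_neg_quadForm ha' hD' 0 0 hr).of_nonneg_of_le (fun _ => norm_nonneg _)
    fun p => ?_
  rw [norm_pow]
  refine (pow_le_pow_left₀ (norm_nonneg _) (le_max_left _ _ : _ ≤ ρ) _).trans_eq ?_
  rw [← Real.rpow_natCast, Real.rpow_def_of_pos h0]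
  congr 1
  have hc : (((a * p.1 ^ 2 + b * p.1 * p.2 + c * p.2 ^ 2).toNat : ℕ) : ℝ) =
      ((a * p.1 ^ 2 + b * p.1 * p.2 + c * p.2 ^ 2 : ℤ) : ℝ) := by
    exact_mod_cast Int.toNat_of_nonneg (form_nonneg ha hD p.1 p.2)
  rw [hc]
  push_cast
  ring

end form

lemma charTheta_zero_eq_formSeries {a b c : ℤ} (ha : 0 < a) (hD : (2 * b) ^ 2 < 4 * a * c)
    (τ : ℂ) : charTheta a b c 0 0 τ = formSeries a (2 * b) c (cexp (Real.pi * I * τ)) := by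
  rw [charTheta_eq, formSeries]
  refine tsum_congr fun p => ?_
  have hc : (((a * p.1 ^ 2 + 2 * b * p.1 * p.2 + c * p.2 ^ 2).toNat : ℕ) : ℂ) =
      ((a * p.1 ^ 2 + 2 * b * p.1 * p.2 + c * p.2 ^ 2 : ℤ) : ℂ) := by
    exact_mod_cast Int.toNat_of_nonneg (form_nonneg ha hD p.1 p.2)
  rw [← Complex.exp_nat_mul, hc]
  congr 1
  push_cast
  ring

lemma formSeries_swap (a b c : ℤ) (q : ℂ) : formSeries a b c q = formSeries c b a q := by
  unfold formSeries
  rw [← (Equiv.prodComm ℤ ℤ).tsum_eq]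
  refine tsum_congr fun p => ?_
  simp only [Equiv.prodComm_apply, Prod.fst_swap, Prod.snd_swap]
  congr 2
  ring

lemma formSeries_shear (a b c k : ℤ) (q : ℂ) :
    formSeries a b c q = formSeries a (b + 2 * a * k) (a * k ^ 2 + b * k + c) q := by
  unfold formSeries
  rw [← (⟨fun p => (p.1 + k * p.2, p.2), fun p => (p.1 - k * p.2, p.2), fun p => by simp,
    fun p => by simp⟩ : ℤ × ℤ ≃ ℤ × ℤ).tsum_eq]
  refine tsum_congr fun p => ?_
  simp only [Equiv.coe_fn_mk]
  congr 2
  ring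

lemma thetaA_eq_formSeries (τ : ℂ) :
    thetaA 0 0 τ = formSeries 1 0 14 (cexp (Real.pi * I * τ)) :=
  charTheta_zero_eq_formSeries (by norm_num) (by norm_num) τ

lemma thetaB_eq_formSeries (τ : ℂ) :
    thetaB 0 0 τ = formSeries 2 0 7 (cexp (Real.pi * I * τ)) := by
  rw [formSeries_swap]
  exact charTheta_zero_eq_formSeries (by norm_num) (by norm_num) τ

/-- Exchanging the variables gives (5, 2, 3), and x ↦ x - 3y then gives (5, -28, 42). -/
lemma thetaC_eq_formSeries (τ : ℂ) :
    thetaC 0 0 τ = formSeries 3 2 5 (cexp (Real.pi * I * τ)) := by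
  rw [formSeries_swap, formSeries_shear _ _ _ (-3)]
  exact charTheta_zero_eq_formSeries (by norm_num) (by norm_num) τ

lemma exists_cexp_eq {q : ℂ} (hq : ‖q‖ < 1) (h0 : q ≠ 0) :
    ∃ τ : ℂ, 0 < τ.im ∧ cexp (Real.pi * I * τ) = q := by
  have hpi : (Real.pi : ℂ) ≠ 0 := ofReal_ne_zero.2 Real.pi_ne_zero
  have hexp : cexp (Real.pi * I * (log q / (Real.pi * I))) = q := by
    rw [mul_div_cancel₀ _ (mul_ne_zero hpi I_ne_zero), exp_log h0]
  refine ⟨_, ?_, hexp⟩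
  have h := norm_cexp_pi_mul 1 (log q / (Real.pi * I))
  rw [ofReal_one, one_mul, hexp, decay, mul_one] at h
  rw [h, Real.exp_lt_one_iff, neg_lt_zero] at hq
  exact pos_of_mul_pos_right hq Real.pi_pos.le

theorem formSeries_sub_eq {q : ℂ} (hq : ‖q‖ < 1) :
    formSeries 1 0 14 q - formSeries 3 2 5 q =
      q * eulerQuot q * (formSeries 2 0 7 q + formSeries 3 2 5 q) := by
  rcases eq_or_ne q 0 with rfl | h0
  -- The point q = 0 is not of the form exp(πiτ); there both sides are 0.
  · rw [formSeries_zero (by norm_num) (by norm_num), formSeries_zero (by norm_num) (by norm_num)]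
    ring
  · obtain ⟨τ, hτ, rfl⟩ := exists_cexp_eq hq h0
    have h := defect₀₀_eq_zero hτ
    rw [defect₀₀, thetaA_eq_formSeries, thetaB_eq_formSeries, thetaC_eq_formSeries,
      etaQuot_eq] at h
    linear_combination h

end thetaIdentity

theorem mainTheorem8 :
    -- the series converge absolutely in the open unit disc
    (∀ q : ℂ, ‖q‖ < 1 →
      (∀ F ∈ ({(1, 0, 14), (2, 0, 7), (3, 2, 5)} : Set (ℤ × ℤ × ℤ)),
        Summable fun p : ℤ × ℤ =>
          ‖q ^ (F.1 * p.1 ^ 2 + F.2.1 * p.1 * p.2 + F.2.2 * p.2 ^ 2).toNat‖) ∧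
      Summable fun n : ℤ =>
        ‖(-q) ^ (n * (n + 1) / 2).toNat * (-q ^ 2) ^ (n * (n - 1) / 2).toNat‖) ∧
    -- the denominator on the left does not vanish identically
    (∃ q : ℂ, ‖q‖ < 1 ∧ formSeries 2 0 7 q + formSeries 3 2 5 q ≠ 0) ∧
    ∀ q Q : ℂ, ‖q‖ < 1 → Q = q ^ 7 →
      -- the denominator on the right never vanishes
      eulerE (Q ^ 2) ^ 2 * eulerE (q ^ 4) ^ 2 ≠ 0 ∧
      -- the identity of quotients, wherever the left-hand side is defined
      (formSeries 2 0 7 q + formSeries 3 2 5 q ≠ 0 →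
        (formSeries 1 0 14 q - formSeries 3 2 5 q) / (formSeries 2 0 7 q + formSeries 3 2 5 q) =
          q * ((eulerE (Q ^ 4) ^ 2 * eulerE (q ^ 2) ^ 2) /
            (eulerE (Q ^ 2) ^ 2 * eulerE (q ^ 4) ^ 2))) ∧
      -- the identity without denominators, everywhere in the disc
      (formSeries 1 0 14 q - formSeries 3 2 5 q) * (eulerE (Q ^ 2) ^ 2 * eulerE (q ^ 4) ^ 2) =
        q * (eulerE (Q ^ 4) ^ 2 * eulerE (q ^ 2) ^ 2) *
          (formSeries 2 0 7 q + formSeries 3 2 5 q) := by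
  refine ⟨fun q hq => ⟨fun F hF => ?_, summable_norm_ramanujanTheta hq⟩, ⟨0, by simp, ?_⟩,
    fun q Q hq hQ => ?_⟩
  · rcases hF with rfl | rfl | rfl <;>
      exact summable_norm_formSeries (by norm_num) (by norm_num) hq
  -- At q = 0 only the zero vector contributes to each series, so the denominator is 2.
  · rw [formSeries_zero (by norm_num) (by norm_num), formSeries_zero (by norm_num) (by norm_num)]
    norm_num
  · subst hQ
    have hpow (n : ℕ) (hn : n ≠ 0) : ‖q ^ n‖ < 1 := by
      rw [norm_pow]; exact pow_lt_one₀ (norm_nonneg _) hq hn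
    rw [← pow_mul, ← pow_mul, eulerE_eq_eulerProd (hpow _ (by norm_num)),
      eulerE_eq_eulerProd (hpow _ (by norm_num)), eulerE_eq_eulerProd (hpow _ (by norm_num)),
      eulerE_eq_eulerProd (hpow _ (by norm_num))]
    have h14 := eulerProd_ne_zero (hpow (7 * 2) (by norm_num))
    have h4 := eulerProd_ne_zero (hpow 4 (by norm_num))
    have hden := mul_ne_zero (pow_ne_zero 2 h14) (pow_ne_zero 2 h4)
    have hmain := formSeries_sub_eq hq
    have hquot : eulerQuot q = eulerProd (q ^ (7 * 4)) ^ 2 * eulerProd (q ^ 2) ^ 2 /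
        (eulerProd (q ^ (7 * 2)) ^ 2 * eulerProd (q ^ 4) ^ 2) := by
      rw [eulerQuot, div_pow, mul_pow, mul_pow]
    rw [hquot] at hmain
    refine ⟨hden, fun h => ?_, ?_⟩
    · rw [hmain, mul_div_cancel_right₀ _ h]
    · rw [hmain]
      field_simp
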